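/- For $x,\xi\in\mathbb R^d$ let $T_xf(t)=f(t-x)$ and $M_\xi f(t)=e^{2\pi i t\cdot\xi}f(t)$, extended to tempered distributions in the usual way. A complex Banach space $E$ is called a *TMIB space* (translation-modulation invariant Banach space of distributions) on $\mathbb R^d$ if (I) $\mathcal S(\mathbb R^d)\subseteq E\subseteq\mathcal S'(\mathbb R^d)$, where both inclusions are continuous and have dense image; (II) $T_x(E)\subseteq E$ and $M_\xi(E)\subseteq E$ for all $x,\xi\in\mathbb R^d$; (III) there are $\tau,C>0$ such that $\|T_x\|_{\mathcal L(E)}\le C(1+|x|)^\tau$ and $\|M_{-\xi}\|_{\mathcal L(E)}\le C(1+|\xi|)^\tau$ for all $x,\xi\in\mathbb R^d$. Let $\mathcal L_c(E,E)$ be the space of continuous linear operators on $E$ with the topology of uniform convergence on compact subsets of $E$, and regard $E'\otimes E$ as a space of finite-rank operators via $(f\otimes e)(x)=f(x)\,e$. **Theorem.** Let $E$ be a TMIB space on $\mathbb R^d$. (a) There are $S_{n,m}\in E'\otimes E$ $(n,m\in\mathbb N)$ such that for every $m$ the limit $G_m=\lim_{n\to\infty}S_{n,m}$ exists in $\mathcal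 L_c(E,E)$, and $\lim_{m\to\infty}G_m=\operatorname{Id}$ in $\mathcal L_c(E,E)$. (b) $E$ has the weak sequential approximation property: there is a sequence in $E'\otimes E$ that converges to $\operatorname{Id}$ in $\mathcal L_c(E,E)$. (c) For every TMIB space $F$ on $\mathbb R^d$, the completed projective tensor product $E\hat\otimes_\pi F$ is a TMIB space on $\mathbb R^{2d}$. That is, there is a continuous linear map $E\hat\otimes_\pi F\to\mathcal S'(\mathbb R^{2d})$ that sends $e\otimes f$ to the tensor product of the distributions $e$ and $f$ (the distribution $w$ with $\langle w,\varphi\otimes\psi\rangle=\langle e,\varphi\rangle\langle f,\psi\rangle$ for all $\varphi,\psi\in\mathcal S(\mathbb R^d)$), and $E\hat\otimes_\pi F$ satisfies (I)-(III) on $\mathbb R^{2d}$ when it is regarded as a space of distributions through this map; in particular the map is injective. -/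

import Mathlib

open Filter Topology
open scoped SchwartzMap TensorProduct ContDiff InnerProductSpace CompactConvergenceCLM

noncomputable section

namespace TMIB

/-! ### Translation and modulation on tempered distributions -/

section Operators

variable {V : Type*} [NormedAddCommGroup V] [InnerProductSpace ℝ V]

/-- Translation of tempered distributions: `⟨T_x u, φ⟩ = ⟨u, φ(· + x)⟩`, which extends
`(T_x f)(t) = f(t - x)`. -/
def translate (x : V) : 𝓢'(V, ℂ) →L[ℂ] 𝓢'(V, ℂ) :=
  PointwiseConvergenceCLM.precomp ℂ (SchwartzMap.compSubConstCLM ℂ (-x))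

/-- The character `t ↦ e^{2πi t·ξ}`. -/
def character (ξ : V) (t : V) : ℂ :=
  Complex.exp (2 * Real.pi * Complex.I * (⟪ξ, t⟫_ℝ : ℝ))

/-- Modulation of tempered distributions: multiplication by `t ↦ e^{2πi t·ξ}`, i.e.
`⟨M_ξ u, φ⟩ = ⟨u, e^{2πi ξ·} φ⟩`. -/
def modulate (ξ : V) : 𝓢'(V, ℂ) →L[ℂ] 𝓢'(V, ℂ) :=
  TemperedDistribution.smulLeftCLM ℂ (character ξ)

/-- Characters have temperate growth, so that `modulate` really is the multiplication. -/
theorem character_hasTemperateGrowth (ξ : V) : (character ξ).HasTemperateGrowth := by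
  have h1 : Function.HasTemperateGrowth
      (fun s : ℝ => Complex.exp (2 * Real.pi * Complex.I * (s : ℂ))) := by
    refine ⟨(contDiff_const.mul Complex.ofRealCLM.contDiff).cexp, fun n => ⟨0, (2 * Real.pi) ^ n, fun s => ?_⟩⟩
    have key : ∀ n : ℕ, iteratedDeriv n
        (fun s : ℝ => Complex.exp (2 * Real.pi * Complex.I * (s : ℂ))) =
        fun s : ℝ => (2 * Real.pi * Complex.I) ^ n *
          Complex.exp (2 * Real.pi * Complex.I * (s : ℂ)) := by
      intro n
      induction n with
      | zero => simp
      | succ n ih =>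
        rw [iteratedDeriv_succ, ih]
        funext s
        have h0 : HasDerivAt (fun s : ℝ => 2 * Real.pi * Complex.I * (s : ℂ))
            (2 * Real.pi * Complex.I) s := by
          simpa using (Complex.ofRealCLM.hasDerivAt (x := s)).const_mul
            (2 * Real.pi * Complex.I)
        rw [(h0.cexp.const_mul _).deriv]
        ring
    rw [norm_iteratedFDeriv_eq_norm_iteratedDeriv, key]
    have : ‖Complex.exp (2 * Real.pi * Complex.I * (s : ℂ))‖ = 1 := by
      have := Complex.norm_exp_ofReal_mul_I (2 * Real.pi * s)
      rw [← this]
      congr 2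
      push_cast
      ring
    simp [this, abs_of_pos Real.pi_pos]
  exact h1.comp (g := fun s : ℝ => Complex.exp (2 * Real.pi * Complex.I * (s : ℂ)))
    (f := fun t : V => ⟪ξ, t⟫_ℝ) (by fun_prop)

theorem translate_apply (x : V) (u : 𝓢'(V, ℂ)) (φ : 𝓢(V, ℂ)) :
    translate x u φ = u (SchwartzMap.compSubConstCLM ℂ (-x) φ) := rfl

theorem modulate_apply (ξ : V) (u : 𝓢'(V, ℂ)) (φ : 𝓢(V, ℂ)) :
    modulate ξ u φ = u (SchwartzMap.smulLeftCLM ℂ (character ξ) φ) := rfl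

end Operators

/-! ### Translation-modulation invariant Banach spaces of distributions -/

/-- `IsTMIB J` says that the normed space `E`, regarded as a space of tempered distributions on
`ℝ^ι` through the inclusion `J : E → 𝓢'(ℝ^ι)`, is a TMIB space. -/
structure IsTMIB {ι : Type*} [Fintype ι] {E : Type*} [NormedAddCommGroup E] [NormedSpace ℂ E]
    (J : E →L[ℂ] 𝓢'(EuclideanSpace ℝ ι, ℂ)) : Prop where
  /-- `E` is a Banach space. -/
  complete : CompleteSpace E
  /-- `E ↪ 𝓢'` is an inclusion (its continuity is built into the type of `J`). -/
  injective : Function.Injective J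
  /-- `E` is dense in `𝓢'`. -/
  dense : DenseRange J
  /-- `𝓢` is continuously and densely included in `E`. -/
  schwartz : ∃ j : 𝓢(EuclideanSpace ℝ ι, ℂ) →L[ℂ] E,
    (∀ φ, J (j φ) = SchwartzMap.toTemperedDistributionCLM (EuclideanSpace ℝ ι) ℂ
      MeasureTheory.volume φ) ∧ DenseRange j
  /-- `T_x E ⊆ E`. -/
  translate_mem : ∀ (x : EuclideanSpace ℝ ι) (e : E), translate x (J e) ∈ Set.range J
  /-- `M_ξ E ⊆ E`. -/
  modulate_mem : ∀ (ξ : EuclideanSpace ℝ ι) (e : E), modulate ξ (J e) ∈ Set.range J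
  /-- `‖T_x‖ ≤ C (1 + |x|)^τ` and `‖M_{-ξ}‖ ≤ C (1 + |ξ|)^τ` as operators on `E`; here `e'`
  is the element `T_x e`, respectively `M_{-ξ} e`, of `E`. -/
  growth : ∃ τ > (0 : ℝ), ∃ C > (0 : ℝ),
    (∀ (x : EuclideanSpace ℝ ι) (e e' : E), J e' = translate x (J e) →
      ‖e'‖ ≤ C * (1 + ‖x‖) ^ τ * ‖e‖) ∧
    (∀ (ξ : EuclideanSpace ℝ ι) (e e' : E), J e' = modulate (-ξ) (J e) →
      ‖e'‖ ≤ C * (1 + ‖ξ‖) ^ τ * ‖e‖)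

/-! ### Finite rank operators and the approximation property -/

section Approximation

variable (E : Type*) [NormedAddCommGroup E] [NormedSpace ℂ E]

/-- The canonical map `E' ⊗ E → 𝓛_c(E, E)`, `f ⊗ e ↦ (x ↦ f(x) e)`. -/
def tensorToOperator : (E →L[ℂ] ℂ) ⊗[ℂ] E →ₗ[ℂ] (E →L_c[ℂ] E) :=
  (ContinuousLinearMap.toUniformConvergenceCLM (RingHom.id ℂ) E
      {S : Set E | IsCompact S}).toLinearMap ∘ₗ
    TensorProduct.lift (LinearMap.mk₂ ℂ
      (fun (f : E →L[ℂ] ℂ) (e : E) => f.smulRight e)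
      (fun f g e => by ext x; simp [add_smul])
      (fun c f e => by ext x; simp [mul_smul])
      (fun f e e' => by ext x; simp [smul_add])
      (fun c f e => by ext x; simp [smul_comm c]))

theorem tensorToOperator_tmul (f : E →L[ℂ] ℂ) (e x : E) :
    tensorToOperator E (f ⊗ₜ e) x = f x • e := rfl

/-- The identity as an element of `𝓛_c(E, E)`. -/
def idOperator : E →L_c[ℂ] E :=
  ContinuousLinearMap.toUniformConvergenceCLM (RingHom.id ℂ) E {S : Set E | IsCompact S}
    (ContinuousLinearMap.id ℂ E)

/-- The weak sequential approximation property of a Banach space: the identity is the limit in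
`𝓛_c(E, E)` of a sequence of operators from `E' ⊗ E`. -/
def HasWeakSequentialApproximationProperty : Prop :=
  idOperator E ∈ seqClosure (Set.range (tensorToOperator E))

end Approximation

/-! ### The completed projective tensor product -/

section Projective

variable (E F : Type*) [NormedAddCommGroup E] [NormedSpace ℂ E]
  [NormedAddCommGroup F] [NormedSpace ℂ F]

/-- A copy of the algebraic tensor product `E ⊗ F`, to carry the projective norm. -/
def ProjTensor : Type _ := E ⊗[ℂ] F

instance : AddCommGroup (ProjTensor E F) := inferInstanceAs (AddCommGroup (E ⊗[ℂ] F))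

instance : Module ℂ (ProjTensor E F) := inferInstanceAs (Module ℂ (E ⊗[ℂ] F))

variable {E F}

/-- The elementary tensor `e ⊗ f` in `E ⊗_π F`. -/
def ProjTensor.tmul (e : E) (f : F) : ProjTensor E F := (e ⊗ₜ[ℂ] f : E ⊗[ℂ] F)

/-- The element `∑ e_i ⊗ f_i` represented by a finite list of pairs. -/
def ProjTensor.ofList (l : List (E × F)) : ProjTensor E F :=
  (l.map fun p => ProjTensor.tmul p.1 p.2).sum

/-- The cost `∑ ‖e_i‖ ‖f_i‖` of a finite list of pairs. -/
def ProjTensor.cost {E F : Type*} [NormedAddCommGroup E] [NormedAddCommGroup F]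
    (l : List (E × F)) : ℝ := (l.map fun p => ‖p.1‖ * ‖p.2‖).sum

theorem ProjTensor.cost_nonneg {E F : Type*} [NormedAddCommGroup E] [NormedAddCommGroup F]
    (l : List (E × F)) : 0 ≤ ProjTensor.cost l := by
  refine List.sum_nonneg fun a ha => ?_
  obtain ⟨p, -, rfl⟩ := List.mem_map.1 ha
  positivity

theorem ProjTensor.exists_ofList (u : ProjTensor E F) : ∃ l, ProjTensor.ofList l = u := by
  refine TensorProduct.induction_on (motive := fun u => ∃ l, ProjTensor.ofList l = u) u
    ⟨[], rfl⟩ (fun e f => ⟨[(e, f)], by simp [ofList]; rfl⟩) ?_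
  rintro _ _ ⟨l, rfl⟩ ⟨l', rfl⟩
  exact ⟨l ++ l', by simp [ofList]; rfl⟩

instance (u : ProjTensor E F) : Nonempty {l : List (E × F) // ProjTensor.ofList l = u} :=
  let ⟨l, hl⟩ := ProjTensor.exists_ofList u
  ⟨⟨l, hl⟩⟩

/-- The projective norm: the infimum of `∑ ‖e_i‖ ‖f_i‖` over all representations
`u = ∑ e_i ⊗ f_i`. -/
instance : Norm (ProjTensor E F) :=
  ⟨fun u => ⨅ l : {l : List (E × F) // ProjTensor.ofList l = u}, ProjTensor.cost l.1⟩

theorem ProjTensor.norm_def (u : ProjTensor E F) :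
    ‖u‖ = ⨅ l : {l : List (E × F) // ProjTensor.ofList l = u}, ProjTensor.cost l.1 := rfl

theorem ProjTensor.norm_ofList_le (l : List (E × F)) : ‖ofList l‖ ≤ cost l :=
  ciInf_le (f := fun l' : {l' : List (E × F) // ofList l' = ofList l} => cost l'.1)
    ⟨0, by rintro _ ⟨l', rfl⟩; exact cost_nonneg _⟩ ⟨l, rfl⟩

theorem ProjTensor.norm_add_le' (u v : ProjTensor E F) : ‖u + v‖ ≤ ‖u‖ + ‖v‖ := by
  refine le_ciInf_add_ciInf fun l l' => ?_
  have h := norm_ofList_le (l.1 ++ l'.1)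
  have e1 : ofList (l.1 ++ l'.1) = u + v := by
    have h1 := l.2
    have h2 := l'.2
    simp only [ofList, List.map_append, List.sum_append] at h1 h2 ⊢
    rw [h1, h2]
  have e2 : cost (l.1 ++ l'.1) = cost l.1 + cost l'.1 := by simp [cost]
  rwa [e1, e2] at h

theorem ProjTensor.norm_smul_le' (c : ℂ) (u : ProjTensor E F) : ‖c • u‖ ≤ ‖c‖ * ‖u‖ := by
  rw [norm_def u, Real.mul_iInf_of_nonneg (norm_nonneg _)]
  refine le_ciInf fun l => ?_
  have h := norm_ofList_le (l.1.map fun p => (c • p.1, p.2))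
  have e1 : ofList (l.1.map fun p => (c • p.1, p.2)) = c • u := by
    refine Eq.trans ?_ (congrArg (c • ·) l.2)
    simp only [ofList, List.map_map, List.smul_sum]
    rfl
  have e2 : cost (l.1.map fun p => (c • p.1, p.2)) = ‖c‖ * cost l.1 := by
    simp [cost, Function.comp_def, norm_smul, mul_assoc, List.sum_map_mul_left]
  rwa [e1, e2] at h

theorem ProjTensor.norm_zero' : ‖(0 : ProjTensor E F)‖ = 0 :=
  le_antisymm (by simpa [ofList, cost] using norm_ofList_le ([] : List (E × F)))
    (le_ciInf fun l => cost_nonneg l.1)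

instance : SeminormedAddCommGroup (ProjTensor E F) :=
  AddGroupSeminorm.toSeminormedAddCommGroup
    (Seminorm.ofSMulLE (𝕜 := ℂ) norm ProjTensor.norm_zero' ProjTensor.norm_add_le'
      ProjTensor.norm_smul_le').toAddGroupSeminorm

instance : NormedSpace ℂ (ProjTensor E F) := ⟨ProjTensor.norm_smul_le'⟩

variable (E F) in
/-- The completed projective tensor product `E ⊗̂_π F`. -/
abbrev CompletedProjTensor : Type _ := UniformSpace.Completion (ProjTensor E F)

/-- The elementary tensor `e ⊗ f` in `E ⊗̂_π F`. -/
def ctmul (e : E) (f : F) : CompletedProjTensor E F :=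
  ((ProjTensor.tmul e f : ProjTensor E F) : CompletedProjTensor E F)

end Projective

/-! ### Tensor products of Schwartz functions and of tempered distributions -/

section Tensor

variable {ι κ : Type*} [Fintype ι] [Fintype κ]

/-- The projection `ℝ^ι × ℝ^κ = ℝ^(ι ⊕ κ) → ℝ^ι`. -/
def projLeft : EuclideanSpace ℝ (ι ⊕ κ) →L[ℝ] EuclideanSpace ℝ ι :=
  LinearMap.toContinuousLinearMap
    { toFun := fun z => WithLp.toLp 2 fun i => z (Sum.inl i)
      map_add' := fun _ _ => rfl
      map_smul' := fun _ _ => rfl }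

/-- The projection `ℝ^ι × ℝ^κ = ℝ^(ι ⊕ κ) → ℝ^κ`. -/
def projRight : EuclideanSpace ℝ (ι ⊕ κ) →L[ℝ] EuclideanSpace ℝ κ :=
  LinearMap.toContinuousLinearMap
    { toFun := fun z => WithLp.toLp 2 fun i => z (Sum.inr i)
      map_add' := fun _ _ => rfl
      map_smul' := fun _ _ => rfl }

theorem projLeft_apply (z : EuclideanSpace ℝ (ι ⊕ κ)) (i : ι) :
    projLeft z i = z (Sum.inl i) := rfl

theorem projRight_apply (z : EuclideanSpace ℝ (ι ⊕ κ)) (i : κ) :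
    projRight z i = z (Sum.inr i) := rfl

theorem norm_le_projLeft_add_projRight (z : EuclideanSpace ℝ (ι ⊕ κ)) :
    ‖z‖ ≤ ‖projLeft z‖ + ‖projRight z‖ := by
  have h : ‖z‖ ^ 2 = ‖projLeft z‖ ^ 2 + ‖projRight z‖ ^ 2 := by
    simp [EuclideanSpace.norm_sq_eq, projLeft_apply, projRight_apply]
  refine (sq_le_sq₀ (norm_nonneg z) (by positivity)).1 ?_
  nlinarith [mul_nonneg (norm_nonneg (projLeft z)) (norm_nonneg (projRight z))]

theorem contDiff_comp_clm {V W : Type*} [NormedAddCommGroup V] [NormedSpace ℝ V]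
    [NormedAddCommGroup W] [NormedSpace ℝ W] (p : V →L[ℝ] W) (φ : 𝓢(W, ℂ)) :
    ContDiff ℝ ∞ fun z => φ (p z) :=
  ContDiff.comp (g := φ) (f := p) (φ.smooth ⊤) p.contDiff

theorem norm_iteratedFDeriv_comp_clm_le {V W : Type*} [NormedAddCommGroup V] [NormedSpace ℝ V]
    [NormedAddCommGroup W] [NormedSpace ℝ W] (p : V →L[ℝ] W) (φ : 𝓢(W, ℂ)) (k i : ℕ) :
    ∃ C : ℝ, 0 ≤ C ∧ ∀ z, ‖p z‖ ^ k * ‖iteratedFDeriv ℝ i (fun z => φ (p z)) z‖ ≤ C := by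
  obtain ⟨C, hC0, hC⟩ := φ.decay k i
  refine ⟨‖p‖ ^ i * C, by positivity, fun z => ?_⟩
  have h1 : iteratedFDeriv ℝ i (fun z => φ (p z)) z =
      (iteratedFDeriv ℝ i φ (p z)).compContinuousLinearMap fun _ => p :=
    p.iteratedFDeriv_comp_right (φ.smooth i) z le_rfl
  have h2 := (iteratedFDeriv ℝ i φ (p z)).norm_compContinuousLinearMap_le fun _ => p
  rw [Finset.prod_const, Finset.card_univ, Fintype.card_fin] at h2
  rw [h1]
  calc _ ≤ ‖p z‖ ^ k * (‖iteratedFDeriv ℝ i φ (p z)‖ * ‖p‖ ^ i) := by gcongr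
    _ = ‖p‖ ^ i * (‖p z‖ ^ k * ‖iteratedFDeriv ℝ i φ (p z)‖) := by ring
    _ ≤ _ := by gcongr; exact hC _

theorem schwartzTensor_decay (φ : 𝓢(EuclideanSpace ℝ ι, ℂ)) (ψ : 𝓢(EuclideanSpace ℝ κ, ℂ))
    (k n : ℕ) : ∃ C : ℝ, ∀ z : EuclideanSpace ℝ (ι ⊕ κ),
      ‖z‖ ^ k * ‖iteratedFDeriv ℝ n (fun z => φ (projLeft z) * ψ (projRight z)) z‖ ≤ C := by
  choose A hA0 hA using norm_iteratedFDeriv_comp_clm_le (projLeft (ι := ι) (κ := κ)) φ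
  choose B hB0 hB using norm_iteratedFDeriv_comp_clm_le (projRight (ι := ι) (κ := κ)) ψ
  refine ⟨∑ i ∈ Finset.range (n + 1), (n.choose i : ℝ) *
    (2 ^ (k - 1) * (A k i * B 0 (n - i) + A 0 i * B k (n - i))), fun z => ?_⟩
  have hs1 : ContDiff ℝ ∞ fun z : EuclideanSpace ℝ (ι ⊕ κ) => φ (projLeft z) :=
    contDiff_comp_clm _ φ
  have hs2 : ContDiff ℝ ∞ fun z : EuclideanSpace ℝ (ι ⊕ κ) => ψ (projRight z) :=
    contDiff_comp_clm _ ψ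
  have h := norm_iteratedFDeriv_mul_le (𝕜 := ℝ) hs1 hs2 z (n := n)
    (by exact_mod_cast (le_top : (n : ℕ∞) ≤ ⊤))
  have hz : ‖z‖ ^ k ≤ 2 ^ (k - 1) * (‖projLeft z‖ ^ k + ‖projRight z‖ ^ k) :=
    (pow_le_pow_left₀ (norm_nonneg z) (norm_le_projLeft_add_projRight z) k).trans
      (add_pow_le (norm_nonneg _) (norm_nonneg _) k)
  refine (mul_le_mul_of_nonneg_left h (by positivity)).trans ?_
  rw [Finset.mul_sum]
  refine Finset.sum_le_sum fun i _ => ?_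
  set a := ‖iteratedFDeriv ℝ i (fun z : EuclideanSpace ℝ (ι ⊕ κ) => φ (projLeft z)) z‖
  set b := ‖iteratedFDeriv ℝ (n - i)
    (fun z : EuclideanSpace ℝ (ι ⊕ κ) => ψ (projRight z)) z‖
  have ha : a ≤ A 0 i := by simpa using hA 0 i z
  have hb : b ≤ B 0 (n - i) := by simpa using hB 0 (n - i) z
  calc ‖z‖ ^ k * ((n.choose i : ℝ) * a * b)
      ≤ 2 ^ (k - 1) * (‖projLeft z‖ ^ k + ‖projRight z‖ ^ k) * ((n.choose i : ℝ) * a * b) := by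
        gcongr
    _ = (n.choose i : ℝ) * (2 ^ (k - 1) *
          ((‖projLeft z‖ ^ k * a) * b + a * (‖projRight z‖ ^ k * b))) := by ring
    _ ≤ _ := by
        gcongr
        · exact hA0 k i
        · exact hA k i z
        · exact hA0 0 i
        · exact hB k (n - i) z

theorem schwartzTensor_contDiff (φ : 𝓢(EuclideanSpace ℝ ι, ℂ))
    (ψ : 𝓢(EuclideanSpace ℝ κ, ℂ)) :
    ContDiff ℝ ∞ fun z : EuclideanSpace ℝ (ι ⊕ κ) => φ (projLeft z) * ψ (projRight z) := by
  have h1 := contDiff_comp_clm (projLeft (ι := ι) (κ := κ)) φ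
  have h2 := contDiff_comp_clm (projRight (ι := ι) (κ := κ)) ψ
  exact h1.mul h2

/-- The tensor product `(φ ⊗ ψ)(x, y) = φ(x) ψ(y)` of two Schwartz functions. -/
def schwartzTensor (φ : 𝓢(EuclideanSpace ℝ ι, ℂ)) (ψ : 𝓢(EuclideanSpace ℝ κ, ℂ)) :
    𝓢(EuclideanSpace ℝ (ι ⊕ κ), ℂ) where
  toFun z := φ (projLeft z) * ψ (projRight z)
  smooth' := schwartzTensor_contDiff φ ψ
  decay' := schwartzTensor_decay φ ψ

/-- `w` is the tensor product `u ⊗ v` of the tempered distributions `u` and `v`. As the span of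
the functions `φ ⊗ ψ` is dense in the Schwartz space, this determines `w`. -/
def IsDistributionTensor (u : 𝓢'(EuclideanSpace ℝ ι, ℂ)) (v : 𝓢'(EuclideanSpace ℝ κ, ℂ))
    (w : 𝓢'(EuclideanSpace ℝ (ι ⊕ κ), ℂ)) : Prop :=
  ∀ (φ : 𝓢(EuclideanSpace ℝ ι, ℂ)) (ψ : 𝓢(EuclideanSpace ℝ κ, ℂ)),
    w (schwartzTensor φ ψ) = u φ * v ψ

end Tensor

end TMIB

end

/-!
Let `ρ`, `h`, `φ` be Schwartz functions. The operator `T_ρ M_h T_φ` on `E`, in which `T_ρ`, `M_h`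
and `T_φ` average translations and modulations, has the kernel `∫ ĥ(y) (T_y φ^∨) ⊗ (T_y ρ) dy`:
it is a norm limit of finite rank operators whose functionals and vectors come from `𝓢`. Letting
`ρ`, `h` and `φ` shrink to the unit mass at `0` gives a bounded sequence of such operators
converging strongly, hence uniformly on compact sets, to the identity. This is (b), and (a)
follows with sequences that are constant in `n`.

For (c), fix windows `h`, `k` and a function `G` dual to `h ⊗ k`. The reproducing formula
`Φ = ∫ V_G Φ(p) π(p) (h ⊗ k) dp` for the short-time Fourier transform `V_G`, with `π(p)` the
time-frequency shift by `p`, writes a Schwartz function on `ℝ^(ι ⊕ κ)` as a superposition of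
elementary tensors, with rapidly decreasing coefficients against polynomially growing norms.
It therefore defines the inclusion of `𝓢` into `E ⊗̂_π F` and, dually, the pairing of `E ⊗̂_π F`
with `𝓢`. If `u` is mapped to the zero distribution then all its slices against
Schwartz functions vanish, so `(S ⊗ id) u = 0` for the finite rank operators `S` of (b), and
`u = lim (S ⊗ id) u = 0`.
-/

noncomputable section

namespace TMIB

open MeasureTheory FourierTransform

section PolynomialGrowth

/-- `f` is bounded by a power of `1 + ‖·‖`. -/
def HasPolynomialGrowth {W X : Type*} [SeminormedAddCommGroup W] [SeminormedAddCommGroup X]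
    (f : W → X) : Prop :=
  ∃ (C : ℝ) (N : ℕ), ∀ w, ‖f w‖ ≤ C * (1 + ‖w‖) ^ N

theorem one_add_norm_le_mul {V : Type*} [SeminormedAddCommGroup V] (x y : V) :
    1 + ‖x‖ ≤ (1 + ‖y‖) * (1 + ‖x - y‖) := by
  have h : ‖x‖ ≤ ‖y‖ + ‖x - y‖ := by simpa using norm_add_le y (x - y)
  nlinarith [norm_nonneg y, norm_nonneg (x - y), mul_nonneg (norm_nonneg y) (norm_nonneg (x - y))]

theorem one_add_norm_prod_le {V W : Type*} [SeminormedAddCommGroup V] [SeminormedAddCommGroup W]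
    (p : V × W) : 1 + ‖p‖ ≤ (1 + ‖p.1‖) * (1 + ‖p.2‖) := by
  have h : ‖p‖ ≤ ‖p.1‖ + ‖p.2‖ := max_le_add_of_nonneg (norm_nonneg _) (norm_nonneg _)
  nlinarith [mul_nonneg (norm_nonneg p.1) (norm_nonneg p.2)]

namespace HasPolynomialGrowth

variable {W W' X Y Z : Type*} [SeminormedAddCommGroup W] [SeminormedAddCommGroup W']
  [SeminormedAddCommGroup X] [SeminormedAddCommGroup Y] [SeminormedAddCommGroup Z]

theorem exists_nonneg_le {f : W → X} (hf : HasPolynomialGrowth f) :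
    ∃ (C : ℝ) (N : ℕ), 0 ≤ C ∧ ∀ w, ‖f w‖ ≤ C * (1 + ‖w‖) ^ N := by
  obtain ⟨C, N, h⟩ := hf
  exact ⟨C, N, by simpa using (norm_nonneg _).trans (h 0), h⟩

theorem of_norm_le_const {f : W → X} {C : ℝ} (h : ∀ w, ‖f w‖ ≤ C) : HasPolynomialGrowth f :=
  ⟨C, 0, by simpa using h⟩

theorem of_norm_le_mul {f : W → X} {g : W → Y} {h : W → Z} (hf : HasPolynomialGrowth f)
    (hg : HasPolynomialGrowth g) (hle : ∀ w, ‖h w‖ ≤ ‖f w‖ * ‖g w‖) : HasPolynomialGrowth h := by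
  obtain ⟨A, M, hA0, hA⟩ := hf.exists_nonneg_le
  obtain ⟨B, N, hB⟩ := hg
  refine ⟨A * B, M + N, fun w => (hle w).trans ?_⟩
  calc ‖f w‖ * ‖g w‖ ≤ (A * (1 + ‖w‖) ^ M) * (B * (1 + ‖w‖) ^ N) := by
        gcongr
        exacts [hA w, hB w]
    _ = A * B * (1 + ‖w‖) ^ (M + N) := by rw [pow_add]; ring

theorem of_norm_le {f : W → X} {h : W → Z} (hf : HasPolynomialGrowth f) (C : ℝ)
    (hle : ∀ w, ‖h w‖ ≤ C * ‖f w‖) : HasPolynomialGrowth h := by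
  obtain ⟨A, N, hA⟩ := hf
  refine ⟨|C| * A, N, fun w => (hle w).trans ?_⟩
  rw [mul_assoc]
  gcongr
  exacts [le_abs_self C, hA w]

theorem comp_linear [NormedSpace ℝ W] [NormedSpace ℝ W'] {f : W → X} (hf : HasPolynomialGrowth f)
    (L : W' →L[ℝ] W) : HasPolynomialGrowth fun w => f (L w) := by
  obtain ⟨C, N, hC0, hC⟩ := hf.exists_nonneg_le
  refine ⟨C * (1 + ‖L‖) ^ N, N, fun w => (hC (L w)).trans ?_⟩
  rw [mul_assoc, ← mul_pow]
  gcongr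
  nlinarith [L.le_opNorm w, norm_nonneg L, norm_nonneg w]

theorem of_rpow {f : W → X} {C τ : ℝ} (hC : 0 ≤ C) (h : ∀ w, ‖f w‖ ≤ C * (1 + ‖w‖) ^ τ) :
    HasPolynomialGrowth f := by
  refine ⟨C, ⌈τ⌉₊, fun w => (h w).trans ?_⟩
  rw [← Real.rpow_natCast]
  gcongr
  exacts [by linarith [norm_nonneg w], Nat.le_ceil τ]

theorem exists_rpow {f : W → X} (hf : HasPolynomialGrowth f) :
    ∃ τ > (0 : ℝ), ∃ C > (0 : ℝ), ∀ w, ‖f w‖ ≤ C * (1 + ‖w‖) ^ τ := by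
  obtain ⟨C, N, hC0, hC⟩ := hf.exists_nonneg_le
  refine ⟨N + 1, by positivity, C + 1, by positivity, fun w => (hC w).trans ?_⟩
  have h1 : 1 ≤ 1 + ‖w‖ := by linarith [norm_nonneg w]
  rw [← Nat.cast_succ, Real.rpow_natCast]
  gcongr
  exacts [by linarith, Nat.le_succ N]

theorem prodMk {f : W → X} {g : W → Y} (hf : HasPolynomialGrowth f) (hg : HasPolynomialGrowth g) :
    HasPolynomialGrowth fun w => (f w, g w) := by
  obtain ⟨A, M, hA0, hA⟩ := hf.exists_nonneg_le
  obtain ⟨B, N, hB0, hB⟩ := hg.exists_nonneg_le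
  refine ⟨A + B, M + N, fun w => max_le ((hA w).trans ?_) ((hB w).trans ?_)⟩
  all_goals
    have h1 : 1 ≤ 1 + ‖w‖ := by linarith [norm_nonneg w]
    gcongr <;> first | assumption | omega | linarith

end HasPolynomialGrowth

end PolynomialGrowth

section WeightedSeminorm

variable {V : Type*} [NormedAddCommGroup V] [NormedSpace ℝ V]

/-- A seminorm dominating the suprema of `(1 + ‖t‖) ^ k * ‖D^i φ(t)‖` for `i ≤ n`. -/
def weightedSeminorm (k n : ℕ) : Seminorm ℂ 𝓢(V, ℂ) :=
  (2 ^ k : NNReal) • (Finset.Iic (k, n)).sup (schwartzSeminormFamily ℂ V ℂ)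

theorem continuous_weightedSeminorm (k n : ℕ) :
    Continuous (weightedSeminorm k n : Seminorm ℂ 𝓢(V, ℂ)) :=
  ((schwartz_withSeminorms ℂ V ℂ).finset_sups.continuous_seminorm (Finset.Iic (k, n))).const_smul
    (2 ^ k : NNReal)

theorem one_add_norm_pow_mul_norm_iteratedFDeriv_le (φ : 𝓢(V, ℂ)) (k : ℕ) {i n : ℕ} (hi : i ≤ n)
    (t : V) : (1 + ‖t‖) ^ k * ‖iteratedFDeriv ℝ i φ t‖ ≤ weightedSeminorm k n φ :=
  SchwartzMap.one_add_le_sup_seminorm_apply (𝕜 := ℂ) (m := (k, n)) le_rfl hi φ t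

theorem one_add_norm_pow_mul_norm_le (φ : 𝓢(V, ℂ)) (k : ℕ) (t : V) :
    (1 + ‖t‖) ^ k * ‖φ t‖ ≤ weightedSeminorm k 0 φ := by
  simpa using one_add_norm_pow_mul_norm_iteratedFDeriv_le φ k (Nat.zero_le 0) t

theorem weightedSeminorm_mono {k k' n n' : ℕ} (hk : k ≤ k') (hn : n ≤ n') :
    (weightedSeminorm k n : Seminorm ℂ 𝓢(V, ℂ)) ≤ weightedSeminorm k' n' := by
  have hsup : (Finset.Iic (k, n)).sup (schwartzSeminormFamily ℂ V ℂ) ≤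
      (Finset.Iic (k', n')).sup (schwartzSeminormFamily ℂ V ℂ) :=
    Finset.sup_mono (Finset.Iic_subset_Iic.2 ⟨hk, hn⟩)
  intro φ
  have hpow : (2 : ℝ) ^ k ≤ 2 ^ k' := pow_le_pow_right₀ one_le_two hk
  exact mul_le_mul hpow (hsup φ) (apply_nonneg _ _) (by positivity)

theorem exists_le_mul_weightedSeminorm {p : Seminorm ℂ 𝓢(V, ℂ)} (hp : Continuous p) :
    ∃ (C : NNReal) (k n : ℕ), ∀ φ, p φ ≤ C * weightedSeminorm k n φ := by
  obtain ⟨s, C, -, hC⟩ := Seminorm.bound_of_continuous (schwartz_withSeminorms ℂ V ℂ) p hp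
  obtain ⟨⟨k, n⟩, hs⟩ := s.bddAbove
  refine ⟨C, k, n, fun φ => (hC φ).trans (mul_le_mul_of_nonneg_left ?_ C.2)⟩
  refine Seminorm.finset_sup_apply_le (apply_nonneg _ _) fun m hm => ?_
  calc SchwartzMap.seminorm ℂ m.1 m.2 φ
      ≤ (Finset.Iic (k, n)).sup (schwartzSeminormFamily ℂ V ℂ) φ :=
        Finset.le_sup (f := schwartzSeminormFamily ℂ V ℂ) (Finset.mem_Iic.2 (hs hm)) φ
    _ ≤ weightedSeminorm k n φ := le_mul_of_one_le_left (apply_nonneg _ _) (one_le_pow₀ one_le_two)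

theorem continuous_of_norm_le_weightedSeminorm {X : Type*} [SeminormedAddCommGroup X]
    [NormedSpace ℂ X] (A : 𝓢(V, ℂ) →ₗ[ℂ] X) {C : ℝ} {k n : ℕ}
    (h : ∀ φ, ‖A φ‖ ≤ C * weightedSeminorm k n φ) : Continuous A := by
  refine continuous_of_continuousAt_zero A ?_
  have := continuous_weightedSeminorm (V := V) k n
  have hlim : Tendsto (fun φ : 𝓢(V, ℂ) => C * weightedSeminorm k n φ) (𝓝 0) (𝓝 0) :=
    Continuous.tendsto' (by fun_prop) _ _ (by simp)
  rw [ContinuousAt, map_zero]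
  exact squeeze_zero_norm h hlim

end WeightedSeminorm

section TimeFrequencyShifts

variable {V : Type*} [NormedAddCommGroup V]

section Translation

variable [NormedSpace ℝ V]

/-- Translation `φ ↦ φ(· - x)` of Schwartz functions. -/
def schwartzTranslate (x : V) : 𝓢(V, ℂ) →L[ℂ] 𝓢(V, ℂ) := SchwartzMap.compSubConstCLM ℂ x

@[simp]
theorem schwartzTranslate_apply (x : V) (φ : 𝓢(V, ℂ)) (t : V) :
    schwartzTranslate x φ t = φ (t - x) := rfl

@[simp]
theorem schwartzTranslate_zero (φ : 𝓢(V, ℂ)) : schwartzTranslate 0 φ = φ := by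
  ext t; simp

theorem schwartzTranslate_add (x y : V) (φ : 𝓢(V, ℂ)) :
    schwartzTranslate (x + y) φ = schwartzTranslate x (schwartzTranslate y φ) := by
  ext t; simp [sub_sub]

theorem iteratedFDeriv_schwartzTranslate (x : V) (φ : 𝓢(V, ℂ)) (n : ℕ) (t : V) :
    iteratedFDeriv ℝ n (schwartzTranslate x φ) t = iteratedFDeriv ℝ n φ (t - x) :=
  iteratedFDeriv_comp_sub n x t

theorem seminorm_schwartzTranslate_le (k n : ℕ) (x : V) (φ : 𝓢(V, ℂ)) :
    SchwartzMap.seminorm ℂ k n (schwartzTranslate x φ) ≤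
      (1 + ‖x‖) ^ k * weightedSeminorm k n φ := by
  refine SchwartzMap.seminorm_le_bound ℂ k n _ (by positivity) fun t => ?_
  have ht : ‖t‖ ≤ (1 + ‖x‖) * (1 + ‖t - x‖) := by linarith [one_add_norm_le_mul t x]
  calc ‖t‖ ^ k * ‖iteratedFDeriv ℝ n (schwartzTranslate x φ) t‖
      ≤ ((1 + ‖x‖) * (1 + ‖t - x‖)) ^ k * ‖iteratedFDeriv ℝ n φ (t - x)‖ := by
        rw [iteratedFDeriv_schwartzTranslate]; gcongr
    _ = (1 + ‖x‖) ^ k * ((1 + ‖t - x‖) ^ k * ‖iteratedFDeriv ℝ n φ (t - x)‖) := by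
        rw [mul_pow, mul_assoc]
    _ ≤ _ := by gcongr; exact one_add_norm_pow_mul_norm_iteratedFDeriv_le φ k le_rfl _

theorem pow_mul_norm_iteratedFDeriv_sub_le (φ : 𝓢(V, ℂ)) (k n : ℕ) (t : V) {x : V}
    (hx : ‖x‖ ≤ 1) :
    ‖t‖ ^ k * ‖iteratedFDeriv ℝ n φ (t - x) - iteratedFDeriv ℝ n φ t‖ ≤
      ‖x‖ * weightedSeminorm k (n + 1) φ := by
  have hd : Differentiable ℝ (iteratedFDeriv ℝ n φ) :=
    (φ.smooth ⊤).differentiable_iteratedFDeriv (by exact_mod_cast WithTop.coe_lt_top n)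
  rcases (pow_nonneg (norm_nonneg t) k).eq_or_lt with htk | htk
  · rw [← htk, zero_mul]
    positivity
  have hderiv : ∀ s ∈ Metric.closedBall t 1,
      ‖fderiv ℝ (iteratedFDeriv ℝ n φ) s‖ ≤ weightedSeminorm k (n + 1) φ / ‖t‖ ^ k := by
    intro s hs
    have hts : ‖t‖ ≤ 1 + ‖s‖ := by
      rw [Metric.mem_closedBall, dist_comm, dist_eq_norm] at hs
      linarith [norm_sub_norm_le t s]
    rw [norm_fderiv_iteratedFDeriv, le_div_iff₀' htk]
    refine le_trans ?_ (one_add_norm_pow_mul_norm_iteratedFDeriv_le φ k le_rfl s)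
    gcongr
  have h := (convex_closedBall t 1).norm_image_sub_le_of_norm_fderiv_le
    (fun s _ => hd s) hderiv (x := t) (y := t - x) (by simp) (by simpa using hx)
  rw [sub_sub_cancel_left, norm_neg, div_mul_eq_mul_div, le_div_iff₀' htk] at h
  rwa [mul_comm ‖x‖]

theorem tendsto_schwartzTranslate_zero (φ : 𝓢(V, ℂ)) :
    Tendsto (fun x : V => schwartzTranslate x φ) (𝓝 0) (𝓝 φ) := by
  rw [(schwartz_withSeminorms ℂ V ℂ).tendsto_nhds]
  rintro ⟨k, n⟩ ε hε
  have hlim : Tendsto (fun x : V => ‖x‖ * weightedSeminorm k (n + 1) φ) (𝓝 0) (𝓝 0) :=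
    Continuous.tendsto' (by fun_prop) _ _ (by simp)
  filter_upwards [hlim.eventually (gt_mem_nhds hε), Metric.closedBall_mem_nhds (0 : V) one_pos]
    with x hx hx1
  refine lt_of_le_of_lt (SchwartzMap.seminorm_le_bound ℂ k n _ (by positivity) fun t => ?_) hx
  have hsub : iteratedFDeriv ℝ n (schwartzTranslate x φ - φ : 𝓢(V, ℂ)) t =
      iteratedFDeriv ℝ n φ (t - x) - iteratedFDeriv ℝ n φ t := by
    rw [← iteratedFDeriv_schwartzTranslate]
    exact iteratedFDeriv_sub_apply ((schwartzTranslate x φ).smooth n).contDiffAt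
      (φ.smooth n).contDiffAt
  rw [hsub]
  exact pow_mul_norm_iteratedFDeriv_sub_le φ k n t (by simpa using hx1)

theorem continuous_schwartzTranslate_const (φ : 𝓢(V, ℂ)) :
    Continuous fun x : V => schwartzTranslate x φ := by
  refine continuous_iff_continuousAt.2 fun x => ?_
  have hsub : Tendsto (fun y : V => y - x) (𝓝 x) (𝓝 0) :=
    Continuous.tendsto' (by fun_prop) _ _ (sub_self x)
  have h := ((schwartzTranslate x).continuous.tendsto φ).comp
    ((tendsto_schwartzTranslate_zero φ).comp hsub)
  refine h.congr fun y => ?_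
  simp [← schwartzTranslate_add]

theorem continuous_schwartzTranslate :
    Continuous fun p : V × 𝓢(V, ℂ) => schwartzTranslate p.1 p.2 := by
  refine continuous_iff_continuousAt.2 fun ⟨x, φ⟩ => ?_
  have hdiff : Tendsto (fun p : V × 𝓢(V, ℂ) => schwartzTranslate p.1 (p.2 - φ)) (𝓝 (x, φ))
      (𝓝 0) := by
    rw [(schwartz_withSeminorms ℂ V ℂ).tendsto_nhds]
    rintro ⟨k, n⟩ ε hε
    have hlim : Tendsto (fun p : V × 𝓢(V, ℂ) => (1 + ‖p.1‖) ^ k * weightedSeminorm k n (p.2 - φ))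
        (𝓝 (x, φ)) (𝓝 0) := by
      have := continuous_weightedSeminorm (V := V) k n
      exact Continuous.tendsto' (by fun_prop) _ _ (by simp)
    filter_upwards [hlim.eventually (gt_mem_nhds hε)] with p hp
    simpa using (seminorm_schwartzTranslate_le k n p.1 (p.2 - φ)).trans_lt hp
  have hconst : Tendsto (fun p : V × 𝓢(V, ℂ) => schwartzTranslate p.1 φ) (𝓝 (x, φ))
      (𝓝 (schwartzTranslate x φ)) :=
    ((continuous_schwartzTranslate_const φ).comp continuous_fst).tendsto (x, φ)
  simpa [ContinuousAt] using hdiff.add hconst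

end Translation

variable [InnerProductSpace ℝ V]

theorem character_eq_fourierChar (ξ t : V) : character ξ t = Real.fourierChar ⟪t, ξ⟫_ℝ := by
  rw [Real.fourierChar_apply, character, real_inner_comm]
  congr 1
  push_cast
  ring

theorem norm_character (ξ t : V) : ‖character ξ t‖ = 1 := by
  rw [character_eq_fourierChar, Circle.norm_coe]

theorem character_add (ξ η t : V) : character (ξ + η) t = character ξ t * character η t := by
  simp [character_eq_fourierChar, inner_add_right, AddChar.map_add_eq_mul]

/-- Multiplication of Schwartz functions by the character `t ↦ e^{2πi t·ξ}`. -/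
def schwartzModulate (ξ : V) : 𝓢(V, ℂ) →L[ℂ] 𝓢(V, ℂ) := SchwartzMap.smulLeftCLM ℂ (character ξ)

@[simp]
theorem schwartzModulate_apply (ξ : V) (φ : 𝓢(V, ℂ)) (t : V) :
    schwartzModulate ξ φ t = character ξ t * φ t := by
  simp [schwartzModulate, SchwartzMap.smulLeftCLM_apply_apply (character_hasTemperateGrowth ξ)]

theorem schwartzModulate_zero (φ : 𝓢(V, ℂ)) : schwartzModulate 0 φ = φ := by
  ext t
  simp [character]

/-- The time-frequency shift `M_ξ T_x` of Schwartz functions by `p = (x, ξ)`. -/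
def schwartzShift (p : V × V) : 𝓢(V, ℂ) →L[ℂ] 𝓢(V, ℂ) :=
  schwartzModulate p.2 ∘L schwartzTranslate p.1

@[simp]
theorem schwartzShift_apply (p : V × V) (φ : 𝓢(V, ℂ)) (t : V) :
    schwartzShift p φ t = character p.2 t * φ (t - p.1) := by
  simp [schwartzShift]

theorem translate_eq_comp (x : V) (u : 𝓢'(V, ℂ)) (φ : 𝓢(V, ℂ)) :
    translate x u φ = u (schwartzTranslate (-x) φ) := rfl

theorem modulate_eq_comp (ξ : V) (u : 𝓢'(V, ℂ)) (φ : 𝓢(V, ℂ)) :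
    modulate ξ u φ = u (schwartzModulate ξ φ) := rfl

theorem apply_schwartzShift (p : V × V) (u : 𝓢'(V, ℂ)) (φ : 𝓢(V, ℂ)) :
    u (schwartzShift p φ) = translate (-p.1) (modulate p.2 u) φ := by
  rw [translate_eq_comp, modulate_eq_comp, neg_neg]; rfl

variable [FiniteDimensional ℝ V] [MeasurableSpace V] [BorelSpace V]

theorem fourier_eq_integral_character (φ : 𝓢(V, ℂ)) (ξ : V) :
    𝓕 φ ξ = ∫ t, character (-ξ) t * φ t := by
  rw [SchwartzMap.fourier_coe, Real.fourier_eq]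
  simp_rw [character_eq_fourierChar, inner_neg_right]
  rfl

theorem fourierInv_eq_integral_character (φ : 𝓢(V, ℂ)) (ξ : V) :
    𝓕⁻ φ ξ = ∫ t, character ξ t * φ t := by
  rw [SchwartzMap.fourierInv_coe, Real.fourierInv_eq]
  simp_rw [character_eq_fourierChar]
  rfl

theorem fourier_schwartzModulate (ξ : V) (φ : 𝓢(V, ℂ)) :
    𝓕 (schwartzModulate ξ φ) = schwartzTranslate ξ (𝓕 φ) := by
  ext η
  rw [schwartzTranslate_apply, fourier_eq_integral_character, fourier_eq_integral_character]
  simp only [schwartzModulate_apply, ← mul_assoc, ← character_add]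
  congr! 4
  abel

theorem continuous_schwartzModulate :
    Continuous fun p : V × 𝓢(V, ℂ) => schwartzModulate p.1 p.2 := by
  have hconj (p : V × 𝓢(V, ℂ)) :
      schwartzModulate p.1 p.2 = 𝓕⁻ (schwartzTranslate p.1 (𝓕 p.2)) := by
    rw [← fourier_schwartzModulate, FourierTransform.fourierInv_fourier_eq]
  simp_rw [hconj]
  exact (FourierTransform.fourierInvCLM ℂ 𝓢(V, ℂ)).continuous.comp
    (continuous_schwartzTranslate.comp (continuous_fst.prodMk
      ((FourierTransform.fourierCLM ℂ 𝓢(V, ℂ)).continuous.comp continuous_snd)))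

theorem continuous_schwartzModulate_const (φ : 𝓢(V, ℂ)) :
    Continuous fun ξ : V => schwartzModulate ξ φ :=
  continuous_schwartzModulate.comp (continuous_id.prodMk continuous_const)

theorem continuous_schwartzShift_const (φ : 𝓢(V, ℂ)) :
    Continuous fun p : V × V => schwartzShift p φ :=
  continuous_schwartzModulate.comp (continuous_snd.prodMk
    ((continuous_schwartzTranslate_const φ).comp continuous_fst))

end TimeFrequencyShifts

section ShortTimeFourier

section WindowedProduct

variable {V : Type*} [NormedAddCommGroup V] [NormedSpace ℝ V]

/-- The pointwise product of two Schwartz functions. -/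
def schwartzMul (φ : 𝓢(V, ℂ)) : 𝓢(V, ℂ) →L[ℂ] 𝓢(V, ℂ) :=
  SchwartzMap.pairing (ContinuousLinearMap.mul ℂ ℂ) φ

@[simp]
theorem schwartzMul_apply (φ ψ : 𝓢(V, ℂ)) (t : V) : schwartzMul φ ψ t = φ t * ψ t := rfl

theorem continuous_schwartzMul_translate (G φ : 𝓢(V, ℂ)) :
    Continuous fun z : V => schwartzMul (schwartzTranslate z G) φ :=
  (SchwartzMap.pairing_continuous_left (ContinuousLinearMap.mul ℂ ℂ) φ).comp
    (continuous_schwartzTranslate_const G)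

theorem one_add_norm_pow_mul_leibniz_term_le (G φ : 𝓢(V, ℂ)) (k N : ℕ) {i n : ℕ} (hi : i ≤ n)
    (z t : V) :
    (1 + ‖z‖) ^ N * (‖t‖ ^ k * (‖iteratedFDeriv ℝ i (schwartzTranslate z G) t‖ *
      ‖iteratedFDeriv ℝ (n - i) φ t‖)) ≤ weightedSeminorm N n G * weightedSeminorm (k + N) n φ := by
  have hz : 1 + ‖z‖ ≤ (1 + ‖t‖) * (1 + ‖t - z‖) := by
    rw [norm_sub_rev]; exact one_add_norm_le_mul z t
  have ht : ‖t‖ ≤ 1 + ‖t‖ := by linarith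
  rw [iteratedFDeriv_schwartzTranslate]
  calc (1 + ‖z‖) ^ N *
        (‖t‖ ^ k * (‖iteratedFDeriv ℝ i G (t - z)‖ * ‖iteratedFDeriv ℝ (n - i) φ t‖))
      ≤ ((1 + ‖t‖) * (1 + ‖t - z‖)) ^ N * ((1 + ‖t‖) ^ k *
        (‖iteratedFDeriv ℝ i G (t - z)‖ * ‖iteratedFDeriv ℝ (n - i) φ t‖)) := by gcongr
    _ = ((1 + ‖t - z‖) ^ N * ‖iteratedFDeriv ℝ i G (t - z)‖) *
        ((1 + ‖t‖) ^ (k + N) * ‖iteratedFDeriv ℝ (n - i) φ t‖) := by rw [mul_pow, pow_add]; ring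
    _ ≤ _ := by
        gcongr
        exacts [one_add_norm_pow_mul_norm_iteratedFDeriv_le G N hi _,
          one_add_norm_pow_mul_norm_iteratedFDeriv_le φ (k + N) (Nat.sub_le n i) t]

theorem one_add_norm_pow_mul_seminorm_schwartzMul_le (G φ : 𝓢(V, ℂ)) (k n N : ℕ) (z : V) :
    (1 + ‖z‖) ^ N * SchwartzMap.seminorm ℂ k n (schwartzMul (schwartzTranslate z G) φ) ≤
      2 ^ n * (weightedSeminorm N n G * weightedSeminorm (k + N) n φ) := by
  rw [← le_div_iff₀' (by positivity)]
  refine SchwartzMap.seminorm_le_bound ℂ k n _ (by positivity) fun t => ?_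
  rw [le_div_iff₀' (by positivity)]
  have hleibniz := norm_iteratedFDeriv_mul_le (𝕜 := ℝ) ((schwartzTranslate z G).smooth ⊤)
    (φ.smooth ⊤) t (n := n) (by exact_mod_cast (le_top : (n : ℕ∞) ≤ ⊤))
  calc (1 + ‖z‖) ^ N * (‖t‖ ^ k *
        ‖iteratedFDeriv ℝ n (schwartzMul (schwartzTranslate z G) φ) t‖)
      ≤ (1 + ‖z‖) ^ N * (‖t‖ ^ k * ∑ i ∈ Finset.range (n + 1), (n.choose i : ℝ) *
        ‖iteratedFDeriv ℝ i (schwartzTranslate z G) t‖ * ‖iteratedFDeriv ℝ (n - i) φ t‖) := by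
        gcongr
        exact hleibniz
    _ = ∑ i ∈ Finset.range (n + 1), (n.choose i : ℝ) * ((1 + ‖z‖) ^ N * (‖t‖ ^ k *
        (‖iteratedFDeriv ℝ i (schwartzTranslate z G) t‖ * ‖iteratedFDeriv ℝ (n - i) φ t‖))) := by
        rw [Finset.mul_sum, Finset.mul_sum]
        exact Finset.sum_congr rfl fun i _ => by ring
    _ ≤ ∑ i ∈ Finset.range (n + 1), (n.choose i : ℝ) *
        (weightedSeminorm N n G * weightedSeminorm (k + N) n φ) := by
        refine Finset.sum_le_sum fun i hi => mul_le_mul_of_nonneg_left ?_ (Nat.cast_nonneg _)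
        exact one_add_norm_pow_mul_leibniz_term_le G φ k N (Finset.mem_range_succ_iff.1 hi) z t
    _ = 2 ^ n * (weightedSeminorm N n G * weightedSeminorm (k + N) n φ) := by
        rw [← Finset.sum_mul, ← Nat.cast_sum, Nat.sum_range_choose, Nat.cast_pow, Nat.cast_ofNat]

theorem one_add_norm_pow_mul_weightedSeminorm_schwartzMul_le (G φ : 𝓢(V, ℂ)) (k n N : ℕ) (z : V) :
    (1 + ‖z‖) ^ N * weightedSeminorm k n (schwartzMul (schwartzTranslate z G) φ) ≤
      2 ^ (k + n) * (weightedSeminorm N n G * weightedSeminorm (k + N) n φ) := by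
  have hsup : (Finset.Iic (k, n)).sup (schwartzSeminormFamily ℂ V ℂ)
      (schwartzMul (schwartzTranslate z G) φ) ≤
        2 ^ n * (weightedSeminorm N n G * weightedSeminorm (k + N) n φ) / (1 + ‖z‖) ^ N := by
    refine Seminorm.finset_sup_apply_le (by positivity) fun m hm => ?_
    obtain ⟨hk, hn⟩ : m.1 ≤ k ∧ m.2 ≤ n := Finset.mem_Iic.1 hm
    rw [le_div_iff₀' (by positivity)]
    refine (one_add_norm_pow_mul_seminorm_schwartzMul_le G φ m.1 m.2 N z).trans ?_
    gcongr
    exacts [one_le_two, weightedSeminorm_mono le_rfl hn G, weightedSeminorm_mono (by gcongr) hn φ]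
  rw [le_div_iff₀' (by positivity)] at hsup
  calc _ = 2 ^ k * ((1 + ‖z‖) ^ N * (Finset.Iic (k, n)).sup (schwartzSeminormFamily ℂ V ℂ)
        (schwartzMul (schwartzTranslate z G) φ)) := mul_left_comm _ _ _
    _ ≤ 2 ^ k * (2 ^ n * (weightedSeminorm N n G * weightedSeminorm (k + N) n φ)) := by gcongr
    _ = _ := by rw [pow_add, mul_assoc]

end WindowedProduct

variable {V : Type*} [NormedAddCommGroup V] [InnerProductSpace ℝ V] [FiniteDimensional ℝ V]
  [MeasurableSpace V] [BorelSpace V]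

/-- The short-time Fourier transform of `φ` with window `G`, at `p = (z, ζ)`: the Fourier transform
of `φ · G(· - z)` at `ζ`. -/
def stft (G φ : 𝓢(V, ℂ)) (p : V × V) : ℂ :=
  𝓕 (schwartzMul (schwartzTranslate p.1 G) φ) p.2

theorem stft_add (G φ ψ : 𝓢(V, ℂ)) (p : V × V) :
    stft G (φ + ψ) p = stft G φ p + stft G ψ p := by
  simp [stft, FourierTransform.fourier_add]

theorem stft_smul (G : 𝓢(V, ℂ)) (c : ℂ) (φ : 𝓢(V, ℂ)) (p : V × V) :
    stft G (c • φ) p = c * stft G φ p := by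
  simp [stft, FourierTransform.fourier_smul]

theorem continuous_stft (G φ : 𝓢(V, ℂ)) : Continuous (stft G φ) := by
  have hfourier : Continuous fun z : V => SchwartzMap.toBoundedContinuousFunctionCLM ℂ V ℂ
      (FourierTransform.fourierCLM ℂ 𝓢(V, ℂ) (schwartzMul (schwartzTranslate z G) φ)) := by
    have := continuous_schwartzMul_translate G φ
    fun_prop
  exact (continuous_eval (F := BoundedContinuousFunction V ℂ)).comp
    ((hfourier.comp continuous_fst).prodMk continuous_snd)

theorem exists_one_add_norm_pow_mul_stft_le (G : 𝓢(V, ℂ)) (N : ℕ) :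
    ∃ (C : ℝ) (k n : ℕ), ∀ φ p,
      (1 + ‖p‖) ^ N * ‖stft G φ p‖ ≤ C * weightedSeminorm k n φ := by
  have hfourier : Continuous ((weightedSeminorm N 0).comp
      (FourierTransform.fourierₗ ℂ 𝓢(V, ℂ) (F := 𝓢(V, ℂ)))) :=
    (continuous_weightedSeminorm N 0).comp (FourierTransform.fourierCLM ℂ 𝓢(V, ℂ)).continuous
  obtain ⟨C, k, n, hC⟩ := exists_le_mul_weightedSeminorm hfourier
  refine ⟨C * (2 ^ (k + n) * weightedSeminorm N n G), k + N, n, fun φ p => ?_⟩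
  set f := schwartzMul (schwartzTranslate p.1 G) φ
  calc (1 + ‖p‖) ^ N * ‖stft G φ p‖
      ≤ ((1 + ‖p.1‖) * (1 + ‖p.2‖)) ^ N * ‖𝓕 f p.2‖ := by
        gcongr
        exacts [one_add_norm_prod_le p, le_rfl]
    _ = (1 + ‖p.1‖) ^ N * ((1 + ‖p.2‖) ^ N * ‖𝓕 f p.2‖) := by rw [mul_pow, mul_assoc]
    _ ≤ (1 + ‖p.1‖) ^ N * (C * weightedSeminorm k n f) :=
        mul_le_mul_of_nonneg_left
          ((one_add_norm_pow_mul_norm_le (𝓕 f) N p.2).trans (hC f)) (by positivity)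
    _ = C * ((1 + ‖p.1‖) ^ N * weightedSeminorm k n f) := mul_left_comm _ _ _
    _ ≤ C * (2 ^ (k + n) * (weightedSeminorm N n G * weightedSeminorm (k + N) n φ)) :=
        mul_le_mul_of_nonneg_left
          (one_add_norm_pow_mul_weightedSeminorm_schwartzMul_le G φ k n N p.1) C.2
    _ = _ := by ring

section Synthesis

theorem integrable_inv_one_add_norm_pow {W : Type*} [NormedAddCommGroup W] [NormedSpace ℝ W]
    [FiniteDimensional ℝ W] [MeasurableSpace W] [BorelSpace W] (μ : Measure W)
    [μ.IsAddHaarMeasure] :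
    Integrable (fun x : W => ((1 + ‖x‖) ^ (Module.finrank ℝ W + 1))⁻¹) μ := by
  refine (integrable_one_add_norm (r := ((Module.finrank ℝ W + 1 : ℕ) : ℝ))
    (by push_cast; linarith)).congr (Eventually.of_forall fun x => ?_)
  simp only [Real.rpow_neg (add_nonneg zero_le_one (norm_nonneg x)), Real.rpow_natCast]

theorem integrable_inv_one_add_norm_pow_prod :
    Integrable fun p : V × V => ((1 + ‖p‖) ^ (Module.finrank ℝ (V × V) + 1))⁻¹ := by
  rw [Measure.volume_eq_prod]
  exact integrable_inv_one_add_norm_pow _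

variable {X : Type*} [NormedAddCommGroup X] [NormedSpace ℂ X]

theorem exists_norm_stft_smul_le (G : 𝓢(V, ℂ)) {b : V × V → X} (hb : HasPolynomialGrowth b) :
    ∃ (C : ℝ) (k n : ℕ), ∀ φ p, ‖stft G φ p • b p‖ ≤
      C * weightedSeminorm k n φ * ((1 + ‖p‖) ^ (Module.finrank ℝ (V × V) + 1))⁻¹ := by
  obtain ⟨B, N, hB0, hB⟩ := hb.exists_nonneg_le
  obtain ⟨C, k, n, hC⟩ :=
    exists_one_add_norm_pow_mul_stft_le G (N + (Module.finrank ℝ (V × V) + 1))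
  refine ⟨B * C, k, n, fun φ p => ?_⟩
  rw [norm_smul, ← div_eq_mul_inv, le_div_iff₀ (by positivity)]
  calc ‖stft G φ p‖ * ‖b p‖ * (1 + ‖p‖) ^ (Module.finrank ℝ (V × V) + 1)
      ≤ ‖stft G φ p‖ * (B * (1 + ‖p‖) ^ N) * (1 + ‖p‖) ^ (Module.finrank ℝ (V × V) + 1) := by
        gcongr
        exact hB p
    _ = B * ((1 + ‖p‖) ^ (N + (Module.finrank ℝ (V × V) + 1)) * ‖stft G φ p‖) := by
        rw [pow_add]; ring
    _ ≤ B * (C * weightedSeminorm k n φ) := mul_le_mul_of_nonneg_left (hC φ p) hB0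
    _ = B * C * weightedSeminorm k n φ := (mul_assoc _ _ _).symm

theorem exists_norm_integral_stft_smul_le (G : 𝓢(V, ℂ)) {b : V × V → X}
    (hb : HasPolynomialGrowth b) :
    ∃ (C : ℝ) (k n : ℕ), ∀ φ, ∫ p, ‖stft G φ p • b p‖ ≤ C * weightedSeminorm k n φ := by
  obtain ⟨C, k, n, h⟩ := exists_norm_stft_smul_le G hb
  refine ⟨C * ∫ p : V × V, ((1 + ‖p‖) ^ (Module.finrank ℝ (V × V) + 1))⁻¹, k, n, fun φ => ?_⟩
  rw [mul_right_comm, ← integral_const_mul]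
  exact integral_mono_of_nonneg (Eventually.of_forall fun _ => norm_nonneg _)
    (integrable_inv_one_add_norm_pow_prod.const_mul _) (Eventually.of_forall (h φ))

theorem integrable_stft_smul (G φ : 𝓢(V, ℂ)) {b : V × V → X} (hb : Continuous b)
    (hgrowth : HasPolynomialGrowth b) : Integrable fun p => stft G φ p • b p := by
  obtain ⟨C, k, n, h⟩ := exists_norm_stft_smul_le G hgrowth
  exact Integrable.mono' (integrable_inv_one_add_norm_pow_prod.const_mul _)
    ((continuous_stft G φ).smul hb).aestronglyMeasurable (Eventually.of_forall (h φ))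

/-- The superposition `φ ↦ ∫ V_G φ(p) b(p) dp` of a continuous family `b` of polynomial growth,
with the short-time Fourier transform `V_G φ` of `φ` as density. -/
def synthesis (G : 𝓢(V, ℂ)) (b : V × V → X) (hb : Continuous b)
    (hgrowth : HasPolynomialGrowth b) : 𝓢(V, ℂ) →L[ℂ] X :=
  let A : 𝓢(V, ℂ) →ₗ[ℂ] X :=
    { toFun φ := ∫ p, stft G φ p • b p
      map_add' φ ψ := by
        rw [← integral_add (integrable_stft_smul G φ hb hgrowth)
          (integrable_stft_smul G ψ hb hgrowth)]
        simp only [stft_add, add_smul]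
      map_smul' c φ := by
        rw [RingHom.id_apply, ← integral_smul]
        simp only [stft_smul, mul_smul] }
  { A with
    cont := by
      obtain ⟨C, k, n, h⟩ := exists_norm_integral_stft_smul_le G hgrowth
      exact continuous_of_norm_le_weightedSeminorm A fun φ =>
        (norm_integral_le_integral_norm _).trans (h φ) }

theorem synthesis_apply (G : 𝓢(V, ℂ)) {b : V × V → X} (hb : Continuous b)
    (hgrowth : HasPolynomialGrowth b) (φ : 𝓢(V, ℂ)) :
    synthesis G b hb hgrowth φ = ∫ p, stft G φ p • b p := rfl

theorem map_synthesis {Y : Type*} [NormedAddCommGroup Y] [NormedSpace ℂ Y] [CompleteSpace X]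
    [CompleteSpace Y] (A : X →L[ℂ] Y) (G : 𝓢(V, ℂ)) {b : V × V → X} (hb : Continuous b)
    (hgrowth : HasPolynomialGrowth b) (φ : 𝓢(V, ℂ)) :
    A (synthesis G b hb hgrowth φ) = ∫ p, stft G φ p • A (b p) := by
  rw [synthesis_apply, ← A.integral_comp_comm (integrable_stft_smul G φ hb hgrowth)]
  simp only [map_smul]

end Synthesis

section ReproducingFormula

theorem toTemperedDistributionCLM_apply_eq_integral (φ ψ : 𝓢(V, ℂ)) :
    SchwartzMap.toTemperedDistributionCLM V ℂ volume φ ψ = ∫ t, φ t * ψ t := by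
  refine (SchwartzMap.toTemperedDistributionCLM_apply_apply volume φ ψ).trans ?_
  simp [mul_comm]

theorem integrable_mul (φ ψ : 𝓢(V, ℂ)) : Integrable fun t => φ t * ψ t :=
  (schwartzMul φ ψ).integrable

theorem norm_integral_mul_schwartzShift_le (φ H : 𝓢(V, ℂ)) (p : V × V) :
    ‖∫ t, φ t * schwartzShift p H t‖ ≤ (∫ t, ‖φ t‖) * SchwartzMap.seminorm ℂ 0 0 H := by
  rw [← integral_mul_const]
  refine norm_integral_le_of_norm_le (φ.integrable.norm.mul_const _)
    (Eventually.of_forall fun t => ?_)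
  rw [norm_mul, schwartzShift_apply, norm_mul, norm_character, one_mul]
  gcongr
  exact SchwartzMap.norm_le_seminorm ℂ H _

theorem integral_mul_schwartzShift_eq_fourierInv (H ψ : 𝓢(V, ℂ)) (p : V × V) :
    ∫ t, ψ t * schwartzShift p H t = 𝓕⁻ (schwartzMul ψ (schwartzTranslate p.1 H)) p.2 := by
  rw [fourierInv_eq_integral_character]
  congr with t
  simp only [schwartzShift_apply, schwartzMul_apply, schwartzTranslate_apply]
  ring

theorem integral_stft_mul_integral_schwartzShift (G H φ ψ : 𝓢(V, ℂ)) (z : V) :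
    ∫ ζ, stft G φ (z, ζ) * ∫ t, ψ t * schwartzShift (z, ζ) H t =
      ∫ t, (ψ t * φ t) * (G (t - z) * H (t - z)) := by
  simp_rw [integral_mul_schwartzShift_eq_fourierInv, stft]
  rw [SchwartzMap.integral_fourier_mul_eq, FourierTransform.fourier_fourierInv_eq]
  congr with t
  simp only [schwartzMul_apply, schwartzTranslate_apply]
  ring

theorem integral_integral_mul_comp_sub {f g : V → ℂ} (hf : Integrable f) (hg : Integrable g) :
    ∫ z, ∫ t, f t * g (t - z) = (∫ t, f t) * ∫ t, g t := by
  have hswap : Integrable (Function.uncurry fun z t : V => f t * g (t - z))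
      (volume.prod volume) := by
    refine (Integrable.convolution_integrand (ContinuousLinearMap.mul ℂ ℂ) (μ := volume)
      (ν := (volume : Measure V)) hf hg.comp_neg).congr (Eventually.of_forall fun p => ?_)
    simp [Function.uncurry]
  rw [integral_integral_swap hswap]
  simp_rw [integral_const_mul, integral_sub_left_eq_self]
  rw [integral_mul_const]

theorem integral_stft_mul (G H φ ψ : 𝓢(V, ℂ)) (hGH : ∫ t, G t * H t = 1) :
    ∫ p, stft G φ p * ∫ t, ψ t * schwartzShift p H t = ∫ t, ψ t * φ t := by
  have hcont : Continuous fun p : V × V => ∫ t, ψ t * schwartzShift p H t := by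
    simp_rw [← toTemperedDistributionCLM_apply_eq_integral]
    exact (SchwartzMap.toTemperedDistributionCLM V ℂ volume ψ).continuous.comp
      (continuous_schwartzShift_const H)
  have hint := integrable_stft_smul G φ hcont
    (HasPolynomialGrowth.of_norm_le_const (norm_integral_mul_schwartzShift_le ψ H))
  simp only [smul_eq_mul] at hint
  rw [Measure.volume_eq_prod, integral_prod _ hint]
  simp_rw [integral_stft_mul_integral_schwartzShift]
  rw [integral_integral_mul_comp_sub (integrable_mul ψ φ) (integrable_mul G H), hGH, mul_one]

end ReproducingFormula

end ShortTimeFourier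

section Density

variable {V : Type*} [NormedAddCommGroup V] [InnerProductSpace ℝ V] [FiniteDimensional ℝ V]
  [MeasurableSpace V] [BorelSpace V]

theorem exists_schwartz_integral_eq_one : ∃ h : 𝓢(V, ℂ), ∫ t, h t = 1 := by
  let b : ContDiffBump (0 : V) := ⟨1, 2, one_pos, one_lt_two⟩
  have hcompact : HasCompactSupport fun t => (b.normed volume t : ℂ) :=
    b.hasCompactSupport_normed.comp_left (g := fun r : ℝ => (r : ℂ)) Complex.ofReal_zero
  have hsmooth : ContDiff ℝ ∞ fun t => (b.normed volume t : ℂ) :=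
    Complex.ofRealCLM.contDiff.comp b.contDiff_normed
  refine ⟨hcompact.toSchwartzMap hsmooth, ?_⟩
  calc ∫ t, (b.normed volume t : ℂ) = 1 := by
        rw [integral_complex_ofReal, b.integral_normed, Complex.ofReal_one]

theorem exists_integral_mul_eq_one {H : 𝓢(V, ℂ)} (hH : H ≠ 0) :
    ∃ G : 𝓢(V, ℂ), ∫ t, G t * H t = 1 := by
  suffices ∃ G : 𝓢(V, ℂ), ∫ t, G t * H t ≠ 0 by
    obtain ⟨G, hG⟩ := this
    exact ⟨(∫ t, G t * H t)⁻¹ • G, by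
      simp only [smul_apply, smul_eq_mul, mul_assoc, integral_const_mul,
        inv_mul_cancel₀ hG]⟩
  let conjH : 𝓢(V, ℂ) := SchwartzMap.postcompCLM (Complex.conjCLE : ℂ →L[ℝ] ℂ) H
  have hconj : ∀ t, conjH t * H t = ((‖H t‖ ^ 2 : ℝ) : ℂ) := fun t => by
    simp [conjH, SchwartzMap.postcompCLM_apply, ← Complex.normSq_eq_conj_mul_self,
      Complex.normSq_eq_norm_sq]
  have hint : Integrable fun t => ‖H t‖ ^ 2 :=
    (integrable_mul conjH H).norm.congr (Eventually.of_forall fun t => by simp [hconj])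
  refine ⟨conjH, fun hzero => hH ?_⟩
  simp only [hconj, integral_complex_ofReal, Complex.ofReal_eq_zero] at hzero
  rw [integral_eq_zero_iff_of_nonneg (fun t => by positivity) hint,
    Continuous.ae_eq_iff_eq volume (by fun_prop) continuous_zero] at hzero
  ext t
  simpa using congrFun hzero t

theorem eq_zero_of_integral_mul_eq_zero {H : 𝓢(V, ℂ)} (h : ∀ G : 𝓢(V, ℂ), ∫ t, G t * H t = 0) :
    H = 0 := by
  by_contra hH
  obtain ⟨G, hG⟩ := exists_integral_mul_eq_one hH
  exact zero_ne_one ((h G).symm.trans hG)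

theorem exists_toTemperedDistributionCLM_eqOn (W : Submodule ℂ 𝓢(V, ℂ)) [FiniteDimensional ℂ W]
    (u : 𝓢'(V, ℂ)) :
    ∃ χ : 𝓢(V, ℂ), ∀ φ ∈ W, SchwartzMap.toTemperedDistributionCLM V ℂ volume χ φ = u φ := by
  let restrict : 𝓢'(V, ℂ) →ₗ[ℂ] W →ₗ[ℂ] ℂ :=
    LinearMap.lcomp ℂ ℂ W.subtype ∘ₗ PointwiseConvergenceCLM.coeLM ℂ 𝓢(V, ℂ) ℂ
  let B : 𝓢(V, ℂ) →ₗ[ℂ] W →ₗ[ℂ] ℂ :=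
    restrict ∘ₗ (SchwartzMap.toTemperedDistributionCLM V ℂ volume).toLinearMap
  have hker : LinearMap.ker B.flip = ⊥ := by
    refine LinearMap.ker_eq_bot'.2 fun φ hφ => Subtype.ext ?_
    refine eq_zero_of_integral_mul_eq_zero fun G => ?_
    rw [← toTemperedDistributionCLM_apply_eq_integral]
    exact LinearMap.congr_fun hφ G
  have hrange : LinearMap.range B = ⊤ := by
    rw [← Subspace.dualCoannihilator_dualAnnihilator_eq (W := LinearMap.range B),
      LinearMap.dualCoannihilator_range_eq_ker_flip, hker, Submodule.dualAnnihilator_bot]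
  obtain ⟨χ, hχ⟩ := LinearMap.range_eq_top.1 hrange (restrict u)
  exact ⟨χ, fun φ hφ => LinearMap.congr_fun hχ ⟨φ, hφ⟩⟩

theorem denseRange_toTemperedDistributionCLM :
    DenseRange (SchwartzMap.toTemperedDistributionCLM V ℂ volume) := by
  intro u
  have hind := (PointwiseConvergenceCLM.isEmbedding_coeFn (RingHom.id ℂ) 𝓢(V, ℂ) ℂ).isInducing
  rw [hind.closure_eq_preimage_closure_image, Set.mem_preimage, mem_closure_iff]
  intro o ho huo
  obtain ⟨I, s, hs, hIs⟩ := isOpen_pi_iff.1 ho _ huo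
  have : FiniteDimensional ℂ (Submodule.span ℂ (I : Set 𝓢(V, ℂ))) :=
    FiniteDimensional.span_finset ℂ I
  obtain ⟨χ, hχ⟩ := exists_toTemperedDistributionCLM_eqOn (Submodule.span ℂ (I : Set 𝓢(V, ℂ))) u
  refine ⟨_, hIs fun φ hφ => ?_, _, ⟨χ, rfl⟩, rfl⟩
  rw [hχ φ (Submodule.subset_span hφ)]
  exact (hs φ hφ).2

end Density

section StrongContinuity

variable {E F : Type*} [NormedAddCommGroup E] [NormedSpace ℂ E]
  [NormedAddCommGroup F] [NormedSpace ℂ F]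

theorem equicontinuous_of_norm_le {A : Type*} {U : A → E →L[ℂ] F} {C : ℝ}
    (hU : ∀ a, ‖U a‖ ≤ C) : Equicontinuous ((↑) ∘ U : A → E → F) :=
  ((NormedSpace.equicontinuous_TFAE U).out 5 1).1 (show ∃ C, ∀ a, ‖U a‖ ≤ C from ⟨C, hU⟩)

theorem tendsto_apply_of_dense {A S : Type*} {l : Filter A} {U : A → E →L[ℂ] F} {C : ℝ}
    (hU : ∀ a, ‖U a‖ ≤ C) {j : S → E} (hj : DenseRange j) {U₀ : E →L[ℂ] F}
    (hlim : ∀ s, Tendsto (fun a => U a (j s)) l (𝓝 (U₀ (j s)))) (e : E) :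
    Tendsto (fun a => U a e) l (𝓝 (U₀ e)) :=
  hj.induction_on e
    ((equicontinuous_of_norm_le hU).isClosed_setOfPred_tendsto U₀.continuous) hlim

theorem continuous_apply_of_dense {V S : Type*} [SeminormedAddCommGroup V] {U : V → E →L[ℂ] F}
    (hU : HasPolynomialGrowth U) {j : S → E} (hj : DenseRange j)
    (hcont : ∀ s, Continuous fun x => U x (j s)) (e : E) : Continuous fun x => U x e := by
  obtain ⟨C, N, hC⟩ := hU
  have hpos : ∀ x : V, (1 + ‖x‖) ^ N ≠ 0 := fun x => by positivity
  let W : V → E →L[ℂ] F := fun x => ((1 + ‖x‖) ^ N : ℝ)⁻¹ • U x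
  have hW : ∀ x, ‖W x‖ ≤ C := fun x => by
    rw [norm_smul, norm_inv, Real.norm_of_nonneg (by positivity), inv_mul_le_iff₀ (by positivity),
      mul_comm]
    exact hC x
  have hWcont : Continuous fun x => W x e := continuous_iff_continuousAt.2 fun x =>
    tendsto_apply_of_dense hW hj (U₀ := W x) (fun s => by
      have hinv : Continuous fun x : V => ((1 + ‖x‖) ^ N : ℝ)⁻¹ := by
        fun_prop (disch := exact hpos _)
      exact (hinv.smul (hcont s)).tendsto x) e
  have hUW : (fun x => U x e) = fun x => ((1 + ‖x‖) ^ N : ℝ) • W x e := by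
    funext x
    exact (smul_inv_smul₀ (hpos x) (U x e)).symm
  rw [hUW]
  fun_prop

end StrongContinuity

section Realization

variable {V : Type*} [NormedAddCommGroup V] [InnerProductSpace ℝ V]
  {E : Type*} [NormedAddCommGroup E] [NormedSpace ℂ E]

theorem translate_zero (u : 𝓢'(V, ℂ)) : translate 0 u = u := by
  ext φ
  rw [translate_eq_comp, neg_zero, schwartzTranslate_zero]

theorem modulate_zero (u : 𝓢'(V, ℂ)) : modulate 0 u = u := by
  ext φ
  rw [modulate_eq_comp, schwartzModulate_zero]

theorem exists_operator_of_invariant {J : E →L[ℂ] 𝓢'(V, ℂ)} (hJ : Function.Injective J)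
    (A : 𝓢'(V, ℂ) →L[ℂ] 𝓢'(V, ℂ)) (hA : ∀ e, A (J e) ∈ Set.range J) {B : ℝ} (hB : 0 ≤ B)
    (hbound : ∀ e e', J e' = A (J e) → ‖e'‖ ≤ B * ‖e‖) :
    ∃ U : E →L[ℂ] E, (∀ e, J (U e) = A (J e)) ∧ ‖U‖ ≤ B := by
  choose f hf using hA
  let U : E →ₗ[ℂ] E :=
    { toFun := f
      map_add' := fun e e' => hJ (by simp only [hf, map_add])
      map_smul' := fun c e => hJ (by simp only [hf, map_smul, RingHom.id_apply]) }
  exact ⟨U.mkContinuous B fun e => hbound e _ (hf e), hf, U.mkContinuous_norm_le hB _⟩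

variable [FiniteDimensional ℝ V] [MeasurableSpace V] [BorelSpace V]

theorem translate_toTemperedDistributionCLM (x : V) (φ : 𝓢(V, ℂ)) :
    translate x (SchwartzMap.toTemperedDistributionCLM V ℂ volume φ) =
      SchwartzMap.toTemperedDistributionCLM V ℂ volume (schwartzTranslate x φ) := by
  ext ψ
  rw [translate_eq_comp, toTemperedDistributionCLM_apply_eq_integral,
    toTemperedDistributionCLM_apply_eq_integral, ← integral_sub_right_eq_self _ x]
  simp only [schwartzTranslate_apply, sub_neg_eq_add, sub_add_cancel]

theorem modulate_toTemperedDistributionCLM (ξ : V) (φ : 𝓢(V, ℂ)) :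
    modulate ξ (SchwartzMap.toTemperedDistributionCLM V ℂ volume φ) =
      SchwartzMap.toTemperedDistributionCLM V ℂ volume (schwartzModulate ξ φ) := by
  ext ψ
  rw [modulate_eq_comp, toTemperedDistributionCLM_apply_eq_integral,
    toTemperedDistributionCLM_apply_eq_integral]
  simp only [schwartzModulate_apply, mul_left_comm, mul_assoc]

/-- A TMIB space in operator form: the inclusion of the Schwartz space into `E`, and the
translations and modulations as bounded operators on `E`. The exponents of their bounds are natural
numbers, which loses nothing. -/
structure Realization (J : E →L[ℂ] 𝓢'(V, ℂ)) where
  /-- The inclusion `𝓢 ⊆ E`. -/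
  incl : 𝓢(V, ℂ) →L[ℂ] E
  /-- The operator `T_x` on `E`. -/
  T : V → E →L[ℂ] E
  /-- The operator `M_ξ` on `E`. -/
  M : V → E →L[ℂ] E
  complete : CompleteSpace E
  injective : Function.Injective J
  apply_incl : ∀ φ, J (incl φ) = SchwartzMap.toTemperedDistributionCLM V ℂ volume φ
  dense_incl : DenseRange incl
  apply_T : ∀ x e, J (T x e) = translate x (J e)
  apply_M : ∀ ξ e, J (M ξ e) = modulate ξ (J e)
  growth_T : HasPolynomialGrowth T
  growth_M : HasPolynomialGrowth M

theorem IsTMIB.nonempty_realization {ι : Type*} [Fintype ι]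
    {J : E →L[ℂ] 𝓢'(EuclideanSpace ℝ ι, ℂ)} (hJ : IsTMIB J) : Nonempty (Realization J) := by
  obtain ⟨incl, happly, hdense⟩ := hJ.schwartz
  obtain ⟨τ, -, C, hC, hT, hM⟩ := hJ.growth
  choose T apply_T norm_T_le using fun x => exists_operator_of_invariant hJ.injective (translate x)
    (hJ.translate_mem x) (B := C * (1 + ‖x‖) ^ τ) (by positivity) (hT x)
  choose M apply_M norm_M_le using fun ξ => exists_operator_of_invariant hJ.injective (modulate ξ)
    (hJ.modulate_mem ξ) (B := C * (1 + ‖ξ‖) ^ τ) (by positivity)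
    (by simpa only [neg_neg, norm_neg] using hM (-ξ))
  exact ⟨⟨incl, T, M, hJ.complete, hJ.injective, happly, hdense, apply_T, apply_M,
    .of_rpow hC.le norm_T_le, .of_rpow hC.le norm_M_le⟩⟩

namespace Realization

section Evaluation

variable (J : E →L[ℂ] 𝓢'(V, ℂ))

/-- The linear map `𝓢 → E'` sending `φ` to the form `e ↦ ⟨e, φ⟩`. -/
def evLinear : 𝓢(V, ℂ) →ₗ[ℂ] E →L[ℂ] ℂ where
  toFun φ := (PointwiseConvergenceCLM.evalCLM (RingHom.id ℂ) ℂ φ).comp J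
  map_add' φ ψ := by
    ext e
    exact map_add (PointwiseConvergenceCLM.coeLM ℂ _ ℂ (J e)) φ ψ
  map_smul' c φ := by
    ext e
    exact map_smul (PointwiseConvergenceCLM.coeLM ℂ _ ℂ (J e)) c φ

end Evaluation

variable {J : E →L[ℂ] 𝓢'(V, ℂ)} (R : Realization J)

theorem apply_incl_apply (φ ψ : 𝓢(V, ℂ)) : J (R.incl φ) ψ = ∫ t, φ t * ψ t := by
  rw [R.apply_incl, toTemperedDistributionCLM_apply_eq_integral]

theorem T_incl (x : V) (φ : 𝓢(V, ℂ)) : R.T x (R.incl φ) = R.incl (schwartzTranslate x φ) :=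
  R.injective (by rw [R.apply_T, R.apply_incl, R.apply_incl, translate_toTemperedDistributionCLM])

theorem M_incl (ξ : V) (φ : 𝓢(V, ℂ)) : R.M ξ (R.incl φ) = R.incl (schwartzModulate ξ φ) :=
  R.injective (by rw [R.apply_M, R.apply_incl, R.apply_incl, modulate_toTemperedDistributionCLM])

theorem incl_schwartzShift (p : V × V) (φ : 𝓢(V, ℂ)) :
    R.incl (schwartzShift p φ) = R.M p.2 (R.T p.1 (R.incl φ)) := by
  rw [R.T_incl, R.M_incl]; rfl

theorem T_zero : R.T 0 = .id ℂ E :=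
  ContinuousLinearMap.ext fun e => R.injective (by rw [R.apply_T, translate_zero]; rfl)

theorem M_zero : R.M 0 = .id ℂ E :=
  ContinuousLinearMap.ext fun e => R.injective (by rw [R.apply_M, modulate_zero]; rfl)

theorem continuous_T (e : E) : Continuous fun x => R.T x e :=
  continuous_apply_of_dense R.growth_T R.dense_incl (fun φ => by
    simp only [R.T_incl]
    exact R.incl.continuous.comp (continuous_schwartzTranslate_const φ)) e

theorem continuous_M (e : E) : Continuous fun ξ => R.M ξ e :=
  continuous_apply_of_dense R.growth_M R.dense_incl (fun φ => by
    simp only [R.M_incl]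
    exact R.incl.continuous.comp (continuous_schwartzModulate_const φ)) e

include R in
theorem hasPolynomialGrowth_evLinear_schwartzShift (H : 𝓢(V, ℂ)) :
    HasPolynomialGrowth fun p => evLinear J (schwartzShift p H) := by
  have hT := R.growth_T.comp_linear (-ContinuousLinearMap.fst ℝ V V)
  have hM := R.growth_M.comp_linear (ContinuousLinearMap.snd ℝ V V)
  have hTM : HasPolynomialGrowth fun p : V × V => R.T (-p.1) ∘L R.M p.2 :=
    hT.of_norm_le_mul hM fun p => ContinuousLinearMap.opNorm_comp_le _ _
  refine hTM.of_norm_le ‖evLinear J H‖ fun p => ?_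
  have hcomp : evLinear J (schwartzShift p H) = evLinear J H ∘L R.T (-p.1) ∘L R.M p.2 := by
    ext e
    exact (apply_schwartzShift p (J e) H).trans (by rw [← R.apply_M, ← R.apply_T]; rfl)
  rw [hcomp]
  exact ContinuousLinearMap.opNorm_comp_le _ _

include R in
theorem continuous_evLinear : Continuous (evLinear J) := by
  obtain ⟨H, hH⟩ := exists_schwartz_integral_eq_one (V := V)
  obtain ⟨G, hGH⟩ := exists_integral_mul_eq_one (H := H) (by rintro rfl; simp at hH)
  obtain ⟨B, N, hB0, hB⟩ := (R.hasPolynomialGrowth_evLinear_schwartzShift H).exists_nonneg_le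
  let b : V × V → ℂ := fun p => (B * (1 + ‖p‖) ^ N : ℝ)
  have hb : ∀ p, ‖b p‖ = B * (1 + ‖p‖) ^ N := fun p =>
    (Complex.norm_real _).trans (Real.norm_of_nonneg (by positivity))
  have hbgrowth : HasPolynomialGrowth b := ⟨B, N, fun p => (hb p).le⟩
  obtain ⟨C, k, n, hC⟩ := exists_norm_integral_stft_smul_le G hbgrowth
  refine continuous_of_norm_le_weightedSeminorm _ fun φ => (?_ : _ ≤ _).trans (hC φ)
  refine ContinuousLinearMap.opNorm_le_bound _ (integral_nonneg fun p => norm_nonneg _) fun e => ?_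
  refine R.dense_incl.induction_on e (isClosed_le (by fun_prop) (by fun_prop)) fun χ => ?_
  calc ‖J (R.incl χ) φ‖ = ‖∫ p, stft G φ p * J (R.incl χ) (schwartzShift p H)‖ := by
        simp only [R.apply_incl_apply, integral_stft_mul G H φ χ hGH]
    _ ≤ ∫ p, ‖stft G φ p • b p‖ * ‖R.incl χ‖ := by
        refine norm_integral_le_of_norm_le
          ((integrable_stft_smul G φ (by fun_prop) hbgrowth).norm.mul_const _)
          (Eventually.of_forall fun p => ?_)
        rw [norm_mul, norm_smul, mul_assoc, hb]
        gcongr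
        exact (evLinear J (schwartzShift p H)).le_of_opNorm_le (hB p) (R.incl χ)
    _ = _ := integral_mul_const _ _

/-- The continuous map `𝓢 → E'` sending `φ` to the form `e ↦ ⟨e, φ⟩`. -/
def ev : 𝓢(V, ℂ) →L[ℂ] E →L[ℂ] ℂ := ⟨evLinear J, R.continuous_evLinear⟩

theorem ev_apply (φ : 𝓢(V, ℂ)) (e : E) : R.ev φ e = J e φ := rfl

theorem hasPolynomialGrowth_ev_schwartzShift (H : 𝓢(V, ℂ)) :
    HasPolynomialGrowth fun p => R.ev (schwartzShift p H) :=
  R.hasPolynomialGrowth_evLinear_schwartzShift H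

theorem hasPolynomialGrowth_incl_schwartzShift (H : 𝓢(V, ℂ)) :
    HasPolynomialGrowth fun p => R.incl (schwartzShift p H) := by
  have hM := R.growth_M.comp_linear (ContinuousLinearMap.snd ℝ V V)
  have hT := R.growth_T.comp_linear (ContinuousLinearMap.fst ℝ V V)
  have hTM : HasPolynomialGrowth fun p : V × V => R.M p.2 ∘L R.T p.1 :=
    hM.of_norm_le_mul hT fun p => ContinuousLinearMap.opNorm_comp_le _ _
  refine hTM.of_norm_le ‖R.incl H‖ fun p => ?_
  rw [R.incl_schwartzShift, mul_comm]
  exact (R.M p.2 ∘L R.T p.1).le_opNorm _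

end Realization

end Realization

section StrongConvergence

variable {E F : Type*} [NormedAddCommGroup E] [NormedSpace ℂ E] [CompleteSpace E]
  [NormedAddCommGroup F] [NormedSpace ℂ F]

theorem exists_norm_le_of_tendsto_apply {S : ℕ → E →L[ℂ] F} {S₀ : E → F}
    (hS : ∀ e, Tendsto (fun m => S m e) atTop (𝓝 (S₀ e))) : ∃ C, ∀ m, ‖S m‖ ≤ C :=
  banach_steinhaus fun e =>
    (Metric.isBounded_range_of_tendsto _ (hS e)).exists_norm_le.imp fun _ h m => h _ ⟨m, rfl⟩

theorem tendsto_apply_of_tendsto {S : ℕ → E →L[ℂ] F} {S₀ : E → F}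
    (hS : ∀ e, Tendsto (fun m => S m e) atTop (𝓝 (S₀ e))) {v : ℕ → E} {e : E}
    (hv : Tendsto v atTop (𝓝 e)) : Tendsto (fun m => S m (v m)) atTop (𝓝 (S₀ e)) := by
  obtain ⟨C, hC⟩ := exists_norm_le_of_tendsto_apply hS
  have hdiff : Tendsto (fun m => S m (v m - e)) atTop (𝓝 0) := by
    refine squeeze_zero_norm (fun m => (S m).le_of_opNorm_le (hC m) (v m - e)) ?_
    simpa using (tendsto_iff_norm_sub_tendsto_zero.1 hv).const_mul C
  simpa using hdiff.add (hS e)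

theorem tendsto_idOperator {S : ℕ → E →L[ℂ] E}
    (hS : ∀ e, Tendsto (fun m => S m e) atTop (𝓝 e)) :
    Tendsto (fun m => ContinuousLinearMap.toUniformConvergenceCLM (RingHom.id ℂ) E
      {Q : Set E | IsCompact Q} (S m)) atTop (𝓝 (idOperator E)) := by
  obtain ⟨C, hC⟩ := exists_norm_le_of_tendsto_apply hS
  have hequi : ∀ Q ∈ {Q : Set E | IsCompact Q},
      EquicontinuousOn ((↑) ∘ S : ℕ → E → E) Q := fun Q _ =>
    (equicontinuous_of_norm_le hC).equicontinuousOn Q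
  rw [(UniformConvergenceCLM.isEmbedding_coeFn _ _ _).tendsto_nhds_iff]
  refine (EquicontinuousOn.tendsto_uniformOnFun_iff_pi (fun _ h => h) (Set.sUnion_eq_univ_iff.2
    fun e => ⟨{e}, isCompact_singleton, rfl⟩) hequi _ _).2 (tendsto_pi_nhds.2 hS)

end StrongConvergence

section Averages

/-- A strongly continuous family of operators on `E` whose norm grows at most polynomially. -/
structure OperatorFamily (V : Type*) [NormedAddCommGroup V]
    (E : Type*) [NormedAddCommGroup E] [NormedSpace ℂ E] where
  /-- The operators of the family. -/
  op : V → E →L[ℂ] E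
  growth : HasPolynomialGrowth op
  continuous_apply : ∀ e, Continuous fun x => op x e

variable {V : Type*} [NormedAddCommGroup V] [NormedSpace ℝ V]
  {E : Type*} [NormedAddCommGroup E] [NormedSpace ℂ E]

theorem OperatorFamily.exists_norm_smul_op_le (U : OperatorFamily V E) :
    ∃ (C : ℝ) (N : ℕ), ∀ (h : 𝓢(V, ℂ)) (e : E) (x y : V), ‖y‖ ≤ ‖x‖ →
      ‖h x • U.op y e‖ ≤ C * ‖e‖ * (‖h x‖ * (1 + ‖x‖) ^ N) := by
  obtain ⟨C, N, hC0, hC⟩ := U.growth.exists_nonneg_le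
  refine ⟨C, N, fun h e x y hy => ?_⟩
  calc ‖h x • U.op y e‖ ≤ ‖h x‖ * (C * (1 + ‖y‖) ^ N * ‖e‖) := by
        rw [norm_smul]
        gcongr
        exact (U.op y).le_of_opNorm_le (hC y) e
    _ ≤ ‖h x‖ * (C * (1 + ‖x‖) ^ N * ‖e‖) := by gcongr
    _ = C * ‖e‖ * (‖h x‖ * (1 + ‖x‖) ^ N) := by ring

variable [FiniteDimensional ℝ V] [MeasurableSpace V] [BorelSpace V]

theorem exists_dilate (μ : Measure V) [μ.IsAddHaarMeasure] (h : 𝓢(V, ℂ)) {s : ℝ} (hs : 0 < s) :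
    ∃ h' : 𝓢(V, ℂ), ∀ f : V → E, ∫ x, h' x • f x ∂μ = ∫ x, h x • f (s⁻¹ • x) ∂μ := by
  let L : V ≃L[ℝ] V := ContinuousLinearEquiv.smulLeft (Units.mk0 s hs.ne')
  refine ⟨((s ^ Module.finrank ℝ V : ℝ) : ℂ) • SchwartzMap.compCLMOfContinuousLinearEquiv ℂ L h,
    fun f => ?_⟩
  calc _ = ∫ x, (s ^ Module.finrank ℝ V) • (h (s • x) • f (s⁻¹ • s • x)) ∂μ := by
        congr with x
        rw [inv_smul_smul₀ hs.ne', ← Complex.coe_smul, ← mul_smul]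
        rfl
    _ = _ := by
        rw [integral_smul, Measure.integral_comp_smul_of_nonneg μ
          (fun x => h x • f (s⁻¹ • x)) s (hR := hs.le), smul_inv_smul₀ (by positivity)]

theorem integrable_norm_mul_one_add_norm_pow (μ : Measure V) [μ.IsAddHaarMeasure] (h : 𝓢(V, ℂ))
    (N : ℕ) : Integrable (fun x => ‖h x‖ * (1 + ‖x‖) ^ N) μ := by
  have hcont : Continuous fun x => ‖h x‖ * (1 + ‖x‖) ^ N := by fun_prop
  refine Integrable.mono' ((integrable_inv_one_add_norm_pow μ).const_mul
    (weightedSeminorm (Module.finrank ℝ V + 1 + N) 0 h)) hcont.aestronglyMeasurable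
    (Eventually.of_forall fun x => ?_)
  rw [Real.norm_of_nonneg (by positivity), ← div_eq_mul_inv, le_div_iff₀' (by positivity),
    mul_left_comm, ← pow_add, mul_comm]
  exact one_add_norm_pow_mul_norm_le h _ x

end Averages

namespace OperatorFamily

variable {V : Type*} [NormedAddCommGroup V] [InnerProductSpace ℝ V] [FiniteDimensional ℝ V]
  [MeasurableSpace V] [BorelSpace V] {E : Type*} [NormedAddCommGroup E] [NormedSpace ℂ E]
  (U : OperatorFamily V E)

theorem integrable_smul_op (h : 𝓢(V, ℂ)) (e : E) : Integrable fun x => h x • U.op x e := by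
  obtain ⟨C, N, hC⟩ := U.exists_norm_smul_op_le
  exact Integrable.mono' ((integrable_norm_mul_one_add_norm_pow volume h N).const_mul _)
    (h.continuous.smul (U.continuous_apply e)).aestronglyMeasurable
    (Eventually.of_forall fun x => hC h e x x le_rfl)

/-- The average `∫ h(x) U_x dx` of a family of operators, a strong integral. -/
def average (h : 𝓢(V, ℂ)) : E →L[ℂ] E :=
  let A : E →ₗ[ℂ] E :=
    { toFun e := ∫ x, h x • U.op x e
      map_add' e e' := by
        rw [← integral_add (U.integrable_smul_op h e) (U.integrable_smul_op h e')]
        simp only [map_add, smul_add]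
      map_smul' c e := by
        rw [RingHom.id_apply, ← integral_smul]
        simp only [map_smul, smul_comm c] }
  A.mkContinuousOfExistsBound <| by
    obtain ⟨C, N, hC⟩ := U.exists_norm_smul_op_le
    refine ⟨C * ∫ x, ‖h x‖ * (1 + ‖x‖) ^ N, fun e => ?_⟩
    rw [mul_right_comm, ← integral_const_mul]
    exact norm_integral_le_of_norm_le
      ((integrable_norm_mul_one_add_norm_pow volume h N).const_mul _)
      (Eventually.of_forall fun x => hC h e x x le_rfl)

theorem average_apply (h : 𝓢(V, ℂ)) (e : E) : U.average h e = ∫ x, h x • U.op x e := rfl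

theorem map_average_apply [CompleteSpace E] {X : Type*} [NormedAddCommGroup X] [NormedSpace ℂ X]
    [CompleteSpace X] (L : E →L[ℂ] X) (h : 𝓢(V, ℂ)) (e : E) :
    L (U.average h e) = ∫ x, h x • L (U.op x e) := by
  rw [average_apply, ← L.integral_comp_comm (U.integrable_smul_op h e)]
  simp only [map_smul]

theorem exists_average_tendsto [CompleteSpace E] (hU : U.op 0 = .id ℂ E) :
    ∃ h : ℕ → 𝓢(V, ℂ), ∀ e, Tendsto (fun m => U.average (h m) e) atTop (𝓝 e) := by
  obtain ⟨h, hh⟩ := exists_schwartz_integral_eq_one (V := V)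
  choose k hk using fun m : ℕ => exists_dilate (E := E) volume h (s := m + 1) (by positivity)
  obtain ⟨C, N, hC⟩ := U.exists_norm_smul_op_le
  have hnorm (m : ℕ) (x : V) : ‖((m : ℝ) + 1)⁻¹ • x‖ ≤ ‖x‖ := by
    rw [norm_smul, Real.norm_of_nonneg (by positivity)]
    exact mul_le_of_le_one_left (norm_nonneg x) (inv_le_one_of_one_le₀ (by simp))
  have hshrink (x : V) : Tendsto (fun m : ℕ => ((m : ℝ) + 1)⁻¹ • x) atTop (𝓝 0) := by
    simpa using (tendsto_one_div_add_atTop_nhds_zero_nat (𝕜 := ℝ)).smul_const x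
  refine ⟨k, fun e => ?_⟩
  have he : e = ∫ x, h x • U.op 0 e := by rw [integral_smul_const, hh, hU, one_smul]; rfl
  simp only [average_apply, hk]
  nth_rw 2 [he]
  refine tendsto_integral_of_dominated_convergence _ (fun m => ?_)
    ((integrable_norm_mul_one_add_norm_pow volume h N).const_mul _)
    (fun m => Eventually.of_forall fun x => hC h e x _ (hnorm m x))
    (Eventually.of_forall fun x =>
      (((U.continuous_apply e).tendsto 0).comp (hshrink x)).const_smul (h x))
  exact (h.continuous.smul
    ((U.continuous_apply e).comp (continuous_const_smul _))).aestronglyMeasurable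

end OperatorFamily

section Convolution

variable {V : Type*} [NormedAddCommGroup V] [InnerProductSpace ℝ V] [FiniteDimensional ℝ V]
  [MeasurableSpace V] [BorelSpace V]

/-- The convolution of two Schwartz functions. -/
abbrev schwartzConvolution (φ : 𝓢(V, ℂ)) : 𝓢(V, ℂ) →L[ℂ] 𝓢(V, ℂ) :=
  SchwartzMap.convolution (ContinuousLinearMap.mul ℂ ℂ) φ

theorem schwartzConvolution_comm (φ ψ : 𝓢(V, ℂ)) :
    schwartzConvolution φ ψ = schwartzConvolution ψ φ := by
  rw [← SchwartzMap.convolution_flip, ContinuousLinearMap.flip_mul]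

theorem schwartzConvolution_eq_fourierInv (φ ψ : 𝓢(V, ℂ)) :
    schwartzConvolution φ ψ = 𝓕⁻ (schwartzMul (𝓕 φ) (𝓕 ψ)) := rfl

theorem schwartzConvolution_apply (φ χ : 𝓢(V, ℂ)) (y : V) :
    schwartzConvolution φ χ y = ∫ t, χ t * schwartzTranslate y (𝓕 (𝓕 φ)) t := by
  rw [← fourier_schwartzModulate, ← SchwartzMap.integral_fourier_mul_eq,
    schwartzConvolution_eq_fourierInv, fourierInv_eq_integral_character]
  congr with t
  simp only [schwartzMul_apply, schwartzModulate_apply]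
  ring

theorem fourierInv_schwartzModulate_neg (x : V) (φ : 𝓢(V, ℂ)) :
    𝓕⁻ (schwartzModulate (-x) φ) = schwartzTranslate x (𝓕⁻ φ) := by
  ext η
  rw [schwartzTranslate_apply, fourierInv_eq_integral_character, fourierInv_eq_integral_character]
  simp only [schwartzModulate_apply, ← mul_assoc, ← character_add, sub_eq_add_neg]

theorem integral_schwartzTranslate_mul (x : V) (χ θ : 𝓢(V, ℂ)) :
    ∫ t, schwartzTranslate x χ t * θ t = 𝓕 (schwartzMul (𝓕 χ) (𝓕⁻ θ)) x := by
  have hχ : schwartzTranslate x χ = 𝓕⁻ (schwartzModulate (-x) (𝓕 χ)) := by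
    rw [fourierInv_schwartzModulate_neg, FourierTransform.fourierInv_fourier_eq]
  rw [hχ, SchwartzMap.integral_fourierInv_mul_eq, fourier_eq_integral_character]
  simp only [schwartzModulate_apply, schwartzMul_apply, mul_assoc]

theorem integral_mul_integral_schwartzTranslate (φ χ θ : 𝓢(V, ℂ)) :
    ∫ x, φ x * ∫ t, schwartzTranslate x χ t * θ t = ∫ t, schwartzConvolution φ χ t * θ t := by
  simp_rw [integral_schwartzTranslate_mul]
  rw [← SchwartzMap.integral_fourier_mul_eq, schwartzConvolution_eq_fourierInv,
    SchwartzMap.integral_fourierInv_mul_eq]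
  simp only [schwartzMul_apply, mul_assoc]

theorem integral_mul_integral_schwartzModulate_neg (h χ θ : 𝓢(V, ℂ)) :
    ∫ ξ, h ξ * ∫ t, schwartzModulate (-ξ) χ t * θ t = ∫ t, schwartzMul (𝓕 h) χ t * θ t := by
  have hfourier (ξ : V) : ∫ t, schwartzModulate (-ξ) χ t * θ t = 𝓕 (schwartzMul χ θ) ξ := by
    simp only [fourier_eq_integral_character, schwartzModulate_apply, schwartzMul_apply, mul_assoc]
  simp only [hfourier, ← SchwartzMap.integral_fourier_mul_eq, schwartzMul_apply, mul_assoc]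

end Convolution

theorem integral_mem_of_isClosed {α X : Type*} [MeasurableSpace α] {μ : Measure α}
    [NormedAddCommGroup X] [NormedSpace ℂ X] [CompleteSpace X] {W : Submodule ℂ X}
    (hW : IsClosed (W : Set X)) {f : α → X} (hf : Integrable f μ) (hfW : ∀ a, f a ∈ W) :
    ∫ a, f a ∂μ ∈ W := by
  have : IsClosed (W : Set X) := hW
  have hker (x : X) : W.mkQL x = 0 ↔ x ∈ W := Submodule.Quotient.mk_eq_zero W
  rw [← hker, ← W.mkQL.integral_comp_comm hf]
  simp only [(hker _).2 (hfW _), integral_zero]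

section Approximation

variable {V : Type*} [NormedAddCommGroup V] [InnerProductSpace ℝ V] [FiniteDimensional ℝ V]
  [MeasurableSpace V] [BorelSpace V] {E : Type*} [NormedAddCommGroup E] [NormedSpace ℂ E]
  {J : E →L[ℂ] 𝓢'(V, ℂ)} (R : Realization J)

namespace Realization

/-- The translations `T_x` as a family of operators. -/
def translations : OperatorFamily V E := ⟨R.T, R.growth_T, R.continuous_T⟩

/-- The modulations `M_{-ξ}` as a family of operators. With this sign their averages are
multiplications by Fourier transforms. -/
def modulations : OperatorFamily V E :=
  ⟨fun ξ => R.M (-ξ), R.growth_M.comp_linear (-ContinuousLinearMap.id ℝ V),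
    fun e => (R.continuous_M e).comp continuous_neg⟩

theorem average_translations_incl (φ χ : 𝓢(V, ℂ)) :
    R.translations.average φ (R.incl χ) = R.incl (schwartzConvolution φ χ) := by
  have := R.complete
  refine R.injective (DFunLike.ext _ _ fun θ => ?_)
  rw [← R.ev_apply, OperatorFamily.map_average_apply, R.apply_incl_apply,
    ← integral_mul_integral_schwartzTranslate]
  congr with x
  rw [← R.apply_incl_apply, ← R.T_incl]
  rfl

theorem average_modulations_incl (h χ : 𝓢(V, ℂ)) :
    R.modulations.average h (R.incl χ) = R.incl (schwartzMul (𝓕 h) χ) := by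
  have := R.complete
  refine R.injective (DFunLike.ext _ _ fun θ => ?_)
  rw [← R.ev_apply, OperatorFamily.map_average_apply, R.apply_incl_apply,
    ← integral_mul_integral_schwartzModulate_neg]
  congr with ξ
  rw [← R.apply_incl_apply, ← R.M_incl]
  rfl

/-- The finite rank operators spanned by `e' ↦ ⟨e', φ⟩ e` for test functions `φ` and `e ∈ E`. -/
def testOperators : Submodule ℂ (E →L[ℂ] E) :=
  Submodule.span ℂ (Set.range fun p : 𝓢(V, ℂ) × E => (R.ev p.1).smulRight p.2)

theorem smulRight_mem_testOperators (φ : 𝓢(V, ℂ)) (e : E) :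
    (R.ev φ).smulRight e ∈ R.testOperators :=
  Submodule.subset_span ⟨(φ, e), rfl⟩

theorem integrable_smul_smulRight (ψ θ : 𝓢(V, ℂ)) (e : E) :
    Integrable fun y => ψ y • (R.ev (schwartzTranslate y θ)).smulRight (R.T y e) := by
  have hev : HasPolynomialGrowth fun y => R.ev (schwartzTranslate y θ) := by
    simpa [schwartzShift, schwartzModulate_zero] using
      (R.hasPolynomialGrowth_ev_schwartzShift θ).comp_linear (ContinuousLinearMap.inl ℝ V V)
  have hgrowth : HasPolynomialGrowth fun y =>
      (R.ev (schwartzTranslate y θ)).smulRight (R.T y e) :=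
    hev.of_norm_le_mul (g := fun y => R.T y e)
      (R.growth_T.of_norm_le ‖e‖ fun y => ((R.T y).le_opNorm e).trans_eq (mul_comm _ _))
      fun y => (ContinuousLinearMap.norm_smulRight_apply _ _).le
  have hcont : Continuous fun y => (R.ev (schwartzTranslate y θ)).smulRight (R.T y e) :=
    ((ContinuousLinearMap.smulRightL ℂ E E).continuous.comp
      (R.ev.continuous.comp (continuous_schwartzTranslate_const θ))).clm_apply (R.continuous_T e)
  obtain ⟨C, N, hC⟩ := hgrowth
  refine Integrable.mono' ((integrable_norm_mul_one_add_norm_pow volume ψ N).const_mul C)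
    (ψ.continuous.smul hcont).aestronglyMeasurable (Eventually.of_forall fun y => ?_)
  rw [norm_smul, mul_left_comm]
  gcongr
  exact hC y

/-- The function `𝓕 (𝓕 φ)` is the reflection `t ↦ φ (-t)`. -/
theorem average_comp_eq_integral (ρ h φ : 𝓢(V, ℂ)) :
    R.translations.average ρ ∘L R.modulations.average h ∘L R.translations.average φ =
      ∫ y, 𝓕 h y • (R.ev (schwartzTranslate y (𝓕 (𝓕 φ)))).smulRight (R.T y (R.incl ρ)) := by
  have := R.complete
  refine DFunLike.coe_injective (R.dense_incl.equalizer (ContinuousLinearMap.continuous _)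
    (ContinuousLinearMap.continuous _) (funext fun χ => ?_))
  simp only [Function.comp_apply, ContinuousLinearMap.comp_apply]
  rw [R.average_translations_incl, R.average_modulations_incl, R.average_translations_incl,
    schwartzConvolution_comm, ← R.average_translations_incl,
    ContinuousLinearMap.integral_apply (R.integrable_smul_smulRight _ _ _),
    OperatorFamily.average_apply]
  congr with y
  rw [schwartzMul_apply, schwartzConvolution_apply, ← R.apply_incl_apply, mul_smul]
  rfl

theorem average_comp_mem_closure (ρ h φ : 𝓢(V, ℂ)) :
    R.translations.average ρ ∘L R.modulations.average h ∘L R.translations.average φ ∈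
      R.testOperators.topologicalClosure := by
  have := R.complete
  rw [R.average_comp_eq_integral]
  exact integral_mem_of_isClosed R.testOperators.isClosed_topologicalClosure
    (R.integrable_smul_smulRight _ _ _) fun y => R.testOperators.le_topologicalClosure
      (R.testOperators.smul_mem _ (R.smulRight_mem_testOperators _ _))

theorem exists_tendsto_testOperators : ∃ S : ℕ → E →L[ℂ] E, (∀ m, S m ∈ R.testOperators) ∧
    ∀ e, Tendsto (fun m => S m e) atTop (𝓝 e) := by
  have := R.complete
  obtain ⟨φ, hφ⟩ := R.translations.exists_average_tendsto R.T_zero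
  obtain ⟨h, hh⟩ := R.modulations.exists_average_tendsto
    ((congrArg R.M neg_zero).trans R.M_zero)
  let G (m : ℕ) : E →L[ℂ] E :=
    R.translations.average (φ m) ∘L R.modulations.average (h m) ∘L R.translations.average (φ m)
  have hG (e : E) : Tendsto (fun m => G m e) atTop (𝓝 e) :=
    tendsto_apply_of_tendsto hφ (tendsto_apply_of_tendsto hh (hφ e))
  have happrox (m : ℕ) : ∃ S ∈ R.testOperators, dist (G m) S < 1 / ((m : ℝ) + 1) :=
    Metric.mem_closure_iff.1 (R.average_comp_mem_closure (φ m) (h m) (φ m)) _ (by positivity)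
  choose S hS hGS using happrox
  refine ⟨S, hS, fun e => ?_⟩
  have hdiff : Tendsto (fun m => (G m - S m) e) atTop (𝓝 0) := by
    refine squeeze_zero_norm (a := fun m : ℕ => 1 / ((m : ℝ) + 1) * ‖e‖) (fun m =>
      (G m - S m).le_of_opNorm_le (by simpa only [dist_eq_norm] using (hGS m).le) e) ?_
    simpa using (tendsto_one_div_add_atTop_nhds_zero_nat (𝕜 := ℝ)).mul_const ‖e‖
  simpa using (hG e).sub hdiff

theorem testOperators_le_range : R.testOperators ≤ (LinearMap.range (tensorToOperator E)).comap
    (ContinuousLinearMap.toUniformConvergenceCLM (RingHom.id ℂ) E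
      {Q : Set E | IsCompact Q}).toLinearMap :=
  Submodule.span_le.2 <| by
    rintro _ ⟨p, rfl⟩
    exact ⟨R.ev p.1 ⊗ₜ p.2, rfl⟩

include R in
theorem exists_tendsto_tensorToOperator : ∃ s : ℕ → (E →L[ℂ] ℂ) ⊗[ℂ] E,
    Tendsto (fun m => tensorToOperator E (s m)) atTop (𝓝 (idOperator E)) := by
  have := R.complete
  obtain ⟨S, hS, hlim⟩ := R.exists_tendsto_testOperators
  choose s hs using fun m => R.testOperators_le_range (hS m)
  refine ⟨s, ?_⟩
  simp only [hs]
  exact tendsto_idOperator hlim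

end Realization

end Approximation

section ProjectiveTensor

theorem ProjTensor.cost_cons {E F : Type*} [NormedAddCommGroup E] [NormedAddCommGroup F]
    (p : E × F) (l : List (E × F)) : cost (p :: l) = ‖p.1‖ * ‖p.2‖ + cost l := by
  simp only [cost, List.map_cons, List.sum_cons]

variable {E F X : Type*} [NormedAddCommGroup E] [NormedSpace ℂ E] [NormedAddCommGroup F]
  [NormedSpace ℂ F] [NormedAddCommGroup X] [NormedSpace ℂ X]

theorem ProjTensor.ofList_cons (p : E × F) (l : List (E × F)) :
    ofList (p :: l) = tmul p.1 p.2 + ofList l := by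
  simp only [ofList, List.map_cons, List.sum_cons]

/-- The linear map on the algebraic tensor product `E ⊗ F` induced by a bounded bilinear map. -/
def ProjTensor.lift (B : E →L[ℂ] F →L[ℂ] X) : ProjTensor E F →ₗ[ℂ] X :=
  (TensorProduct.lift B.toLinearMap₁₂ : E ⊗[ℂ] F →ₗ[ℂ] X)

theorem ProjTensor.lift_tmul (B : E →L[ℂ] F →L[ℂ] X) (e : E) (f : F) :
    lift B (tmul e f) = B e f :=
  TensorProduct.lift.tmul e f

theorem ProjTensor.norm_lift_le (B : E →L[ℂ] F →L[ℂ] X) (u : ProjTensor E F) :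
    ‖lift B u‖ ≤ ‖B‖ * ‖u‖ := by
  rw [norm_def, Real.mul_iInf_of_nonneg (norm_nonneg B)]
  refine le_ciInf ?_
  rintro ⟨l, rfl⟩
  induction l with
  | nil => simp [ofList, cost]
  | cons p l ih =>
    simp only at ih ⊢
    rw [ofList_cons, cost_cons, map_add, lift_tmul, mul_add, ← mul_assoc]
    exact (norm_add_le _ _).trans (add_le_add (B.le_opNorm₂ p.1 p.2) ih)

theorem ProjTensor.norm_lift_le_norm_coe (B : E →L[ℂ] F →L[ℂ] X) (u : ProjTensor E F) :
    ‖lift B u‖ ≤ ‖B‖ * ‖(u : CompletedProjTensor E F)‖ :=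
  (norm_lift_le B u).trans_eq (congrArg (‖B‖ * ·) (UniformSpace.Completion.norm_coe u).symm)

theorem norm_ctmul_le (e : E) (f : F) : ‖ctmul e f‖ ≤ ‖e‖ * ‖f‖ := by
  refine (UniformSpace.Completion.norm_coe (ProjTensor.tmul e f)).le.trans ?_
  change @norm (ProjTensor E F) instNormProjTensor _ ≤ _
  simpa [ProjTensor.ofList, ProjTensor.cost] using ProjTensor.norm_ofList_le [(e, f)]

variable (E F) in
/-- The canonical bilinear map `E × F → E ⊗̂_π F`. -/
def ctmulCLM : E →L[ℂ] F →L[ℂ] CompletedProjTensor E F :=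
  LinearMap.mkContinuous₂
    (((TensorProduct.mk ℂ E F : E →ₗ[ℂ] F →ₗ[ℂ] ProjTensor E F)).compr₂
      (UniformSpace.Completion.toComplL (𝕜 := ℂ) (E := ProjTensor E F)).toLinearMap)
    1 fun e f => by rw [one_mul]; exact norm_ctmul_le e f

theorem ctmulCLM_apply (e : E) (f : F) : ctmulCLM E F e f = ctmul e f := rfl

theorem dense_span_ctmul :
    Dense (Submodule.span ℂ (Set.range fun p : E × F => ctmul p.1 p.2) :
      Set (CompletedProjTensor E F)) := by
  refine (UniformSpace.Completion.denseRange_coe (α := ProjTensor E F)).mono ?_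
  rintro _ ⟨u, rfl⟩
  obtain ⟨l, rfl⟩ := ProjTensor.exists_ofList u
  induction l with
  | nil => exact Submodule.zero_mem _
  | cons p l ih =>
    rw [ProjTensor.ofList_cons, UniformSpace.Completion.coe_add]
    exact Submodule.add_mem _ (Submodule.subset_span ⟨p, rfl⟩) ih

theorem dense_span_ctmul_of_denseRange {S S' : Type*} {j : S → E} {k : S' → F}
    (hj : DenseRange j) (hk : DenseRange k) :
    Dense (Submodule.span ℂ (Set.range fun p : S × S' => ctmul (j p.1) (k p.2)) :
      Set (CompletedProjTensor E F)) := by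
  let D := (Submodule.span ℂ
    (Set.range fun p : S × S' => ctmul (j p.1) (k p.2))).topologicalClosure
  have hD : IsClosed (D : Set (CompletedProjTensor E F)) := Submodule.isClosed_topologicalClosure _
  have hmem (p : E × F) : ctmul p.1 p.2 ∈ D :=
    (hj.prodMap hk).induction_on p (hD.preimage (ctmulCLM E F).continuous₂) fun s =>
      Submodule.le_topologicalClosure _ (Submodule.subset_span ⟨s, rfl⟩)
  exact dense_closure.1 (dense_span_ctmul.mono
    (Submodule.span_le.2 (Set.range_subset_iff.2 hmem)))

theorem eq_of_forall_ctmul_of_denseRange {S S' Y : Type*} [AddCommGroup Y] [Module ℂ Y]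
    [TopologicalSpace Y] [T2Space Y] {A B : CompletedProjTensor E F →L[ℂ] Y} {j : S → E}
    {k : S' → F} (hj : DenseRange j) (hk : DenseRange k)
    (h : ∀ s t, A (ctmul (j s) (k t)) = B (ctmul (j s) (k t))) : A = B :=
  ContinuousLinearMap.ext_on (dense_span_ctmul_of_denseRange hj hk)
    (by rintro _ ⟨p, rfl⟩; exact h p.1 p.2)

theorem eq_of_forall_ctmul {Y : Type*} [AddCommGroup Y] [Module ℂ Y] [TopologicalSpace Y]
    [T2Space Y] {A B : CompletedProjTensor E F →L[ℂ] Y}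
    (h : ∀ e f, A (ctmul e f) = B (ctmul e f)) : A = B :=
  eq_of_forall_ctmul_of_denseRange denseRange_id denseRange_id h

section Lift

variable [CompleteSpace X]

/-- The continuous extension of `ProjTensor.lift B` to `E ⊗̂_π F`. -/
def projLiftFun (B : E →L[ℂ] F →L[ℂ] X) : CompletedProjTensor E F →L[ℂ] X :=
  LinearMap.extendOfNorm (ProjTensor.lift B)
    (UniformSpace.Completion.toComplL (𝕜 := ℂ) (E := ProjTensor E F)).toLinearMap

theorem projLiftFun_ctmul (B : E →L[ℂ] F →L[ℂ] X) (e : E) (f : F) :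
    projLiftFun B (ctmul e f) = B e f := by
  rw [← ProjTensor.lift_tmul]
  exact LinearMap.extendOfNorm_eq UniformSpace.Completion.denseRange_coe
    ⟨‖B‖, ProjTensor.norm_lift_le_norm_coe B⟩ _

theorem norm_projLiftFun_le (B : E →L[ℂ] F →L[ℂ] X) : ‖projLiftFun B‖ ≤ ‖B‖ :=
  LinearMap.opNorm_extendOfNorm_le UniformSpace.Completion.denseRange_coe (norm_nonneg B)
    (ProjTensor.norm_lift_le_norm_coe B)

/-- The universal property of `E ⊗̂_π F`: a bounded bilinear map `B` induces a bounded operator, and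
this operator depends linearly and continuously on `B`. -/
def projLift : (E →L[ℂ] F →L[ℂ] X) →L[ℂ] (CompletedProjTensor E F →L[ℂ] X) :=
  LinearMap.mkContinuous
    { toFun := (projLiftFun : (E →L[ℂ] F →L[ℂ] X) → _)
      map_add' := fun B B' => eq_of_forall_ctmul fun e f => by
        simp only [add_apply, projLiftFun_ctmul]
      map_smul' := fun c B => eq_of_forall_ctmul fun e f => by
        simp only [smul_apply, projLiftFun_ctmul, RingHom.id_apply] }
    1 fun B => by rw [one_mul]; exact norm_projLiftFun_le B

@[simp]
theorem projLift_ctmul (B : E →L[ℂ] F →L[ℂ] X) (e : E) (f : F) :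
    projLift B (ctmul e f) = B e f :=
  projLiftFun_ctmul B e f

theorem norm_projLift_apply_le (B : E →L[ℂ] F →L[ℂ] X) : ‖projLift B‖ ≤ ‖B‖ :=
  norm_projLiftFun_le B

end Lift

/-- The tensor product `A ⊗ B` of two operators. -/
def projMap (A : E →L[ℂ] E) (B : F →L[ℂ] F) :
    CompletedProjTensor E F →L[ℂ] CompletedProjTensor E F :=
  projLift ((ctmulCLM E F).bilinearComp A B)

@[simp]
theorem projMap_ctmul (A : E →L[ℂ] E) (B : F →L[ℂ] F) (e : E) (f : F) :
    projMap A B (ctmul e f) = ctmul (A e) (B f) :=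
  projLift_ctmul _ e f

theorem norm_projMap_le (A : E →L[ℂ] E) (B : F →L[ℂ] F) : ‖projMap A B‖ ≤ ‖A‖ * ‖B‖ := by
  refine (norm_projLift_apply_le _).trans ?_
  refine ContinuousLinearMap.opNorm_le_bound₂ _ (by positivity) fun e f => ?_
  calc ‖ctmul (A e) (B f)‖ ≤ ‖A e‖ * ‖B f‖ := norm_ctmul_le _ _
    _ ≤ (‖A‖ * ‖e‖) * (‖B‖ * ‖f‖) := by gcongr <;> exact ContinuousLinearMap.le_opNorm _ _
    _ = ‖A‖ * ‖B‖ * ‖e‖ * ‖f‖ := by ring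

theorem tendsto_projMap_id [CompleteSpace E] {S : ℕ → E →L[ℂ] E}
    (hS : ∀ e, Tendsto (fun m => S m e) atTop (𝓝 e)) (u : CompletedProjTensor E F) :
    Tendsto (fun m => projMap (S m) (.id ℂ F) u) atTop (𝓝 u) := by
  obtain ⟨C, hC⟩ := exists_norm_le_of_tendsto_apply hS
  have hbound (m : ℕ) : ‖projMap (S m) (.id ℂ F)‖ ≤ C :=
    calc ‖projMap (S m) (.id ℂ F)‖ ≤ ‖S m‖ * 1 :=
          (norm_projMap_le _ _).trans (by gcongr; exact ContinuousLinearMap.norm_id_le)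
      _ ≤ C := (mul_one _).trans_le (hC m)
  refine tendsto_apply_of_dense hbound (dense_span_ctmul (E := E) (F := F)).denseRange_val
    (U₀ := .id ℂ _) ?_ u
  rintro ⟨v, hv⟩
  induction hv using Submodule.span_induction with
  | mem v hv =>
    obtain ⟨p, rfl⟩ := hv
    simp only [projMap_ctmul]
    exact (((ctmulCLM E F).flip p.2).continuous.tendsto p.1).comp (hS p.1)
  | zero => simp
  | add v w _ _ hv hw => simpa using hv.add hw
  | smul c v _ hv => simpa using hv.const_smul c

theorem projMap_smulRight_id [CompleteSpace F] (g : E →L[ℂ] ℂ) (e : E)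
    (u : CompletedProjTensor E F) :
    projMap (g.smulRight e) (.id ℂ F) u = ctmul e (projLift (g.smulRight (.id ℂ F)) u) := by
  refine DFunLike.congr_fun (f := projMap (g.smulRight e) (.id ℂ F))
    (g := ctmulCLM E F e ∘L projLift (g.smulRight (.id ℂ F)))
    (eq_of_forall_ctmul fun e' f => ?_) u
  rw [projMap_ctmul, ContinuousLinearMap.comp_apply, projLift_ctmul, ← ctmulCLM_apply]
  simp

end ProjectiveTensor

section SchwartzTensor

variable {ι κ : Type*} [Fintype ι] [Fintype κ]

theorem measurePreserving_projLeft_projRight : MeasurePreserving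
    (fun z : EuclideanSpace ℝ (ι ⊕ κ) => (projLeft z, projRight z)) :=
  ((PiLp.volume_preserving_toLp ι).prod (PiLp.volume_preserving_toLp κ)).comp
    ((volume_measurePreserving_sumPiEquivProdPi fun _ : ι ⊕ κ => ℝ).comp
      (PiLp.volume_preserving_ofLp (ι ⊕ κ)))

theorem integral_projLeft_mul_projRight {f : EuclideanSpace ℝ ι → ℂ} {g : EuclideanSpace ℝ κ → ℂ}
    (hf : Continuous f) (hg : Continuous g) :
    ∫ z : EuclideanSpace ℝ (ι ⊕ κ), f (projLeft z) * g (projRight z) =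
      (∫ x, f x) * ∫ y, g y := by
  have h := measurePreserving_projLeft_projRight (ι := ι) (κ := κ)
  rw [← integral_prod_mul, ← Measure.volume_eq_prod, ← h.map_eq,
    integral_map h.measurable.aemeasurable (Continuous.aestronglyMeasurable (by fun_prop))]

@[simp]
theorem schwartzTensor_apply (φ : 𝓢(EuclideanSpace ℝ ι, ℂ)) (ψ : 𝓢(EuclideanSpace ℝ κ, ℂ))
    (z : EuclideanSpace ℝ (ι ⊕ κ)) :
    schwartzTensor φ ψ z = φ (projLeft z) * ψ (projRight z) := rfl

theorem integral_schwartzTensor (φ : 𝓢(EuclideanSpace ℝ ι, ℂ)) (ψ : 𝓢(EuclideanSpace ℝ κ, ℂ)) :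
    ∫ z, schwartzTensor φ ψ z = (∫ x, φ x) * ∫ y, ψ y :=
  integral_projLeft_mul_projRight φ.continuous ψ.continuous

theorem integral_schwartzTensor_mul (φ φ' : 𝓢(EuclideanSpace ℝ ι, ℂ))
    (ψ ψ' : 𝓢(EuclideanSpace ℝ κ, ℂ)) :
    ∫ z, schwartzTensor φ ψ z * schwartzTensor φ' ψ' z =
      (∫ x, φ x * φ' x) * ∫ y, ψ y * ψ' y := by
  rw [← integral_projLeft_mul_projRight (f := fun x => φ x * φ' x) (g := fun y => ψ y * ψ' y)
    (by fun_prop) (by fun_prop)]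
  simp only [schwartzTensor_apply, mul_mul_mul_comm]

theorem character_eq_mul (ζ z : EuclideanSpace ℝ (ι ⊕ κ)) : character ζ z =
    character (projLeft ζ) (projLeft z) * character (projRight ζ) (projRight z) := by
  have hinner : ⟪ζ, z⟫_ℝ = ⟪projLeft ζ, projLeft z⟫_ℝ + ⟪projRight ζ, projRight z⟫_ℝ := by
    simp [PiLp.inner_apply, projLeft_apply, projRight_apply]
  rw [character, character, character, ← Complex.exp_add, hinner]
  congr 1
  push_cast
  ring

theorem schwartzTranslate_schwartzTensor (x : EuclideanSpace ℝ (ι ⊕ κ))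
    (φ : 𝓢(EuclideanSpace ℝ ι, ℂ)) (ψ : 𝓢(EuclideanSpace ℝ κ, ℂ)) :
    schwartzTranslate x (schwartzTensor φ ψ) =
      schwartzTensor (schwartzTranslate (projLeft x) φ) (schwartzTranslate (projRight x) ψ) := by
  ext z
  simp

theorem schwartzModulate_schwartzTensor (ξ : EuclideanSpace ℝ (ι ⊕ κ))
    (φ : 𝓢(EuclideanSpace ℝ ι, ℂ)) (ψ : 𝓢(EuclideanSpace ℝ κ, ℂ)) :
    schwartzModulate ξ (schwartzTensor φ ψ) =
      schwartzTensor (schwartzModulate (projLeft ξ) φ) (schwartzModulate (projRight ξ) ψ) := by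
  ext z
  simp only [schwartzModulate_apply, schwartzTensor_apply, character_eq_mul, mul_mul_mul_comm]

/-- The projection of phase space `ℝ^(ι ⊕ κ) × ℝ^(ι ⊕ κ)` onto `ℝ^ι × ℝ^ι`. -/
def phaseLeft : EuclideanSpace ℝ (ι ⊕ κ) × EuclideanSpace ℝ (ι ⊕ κ) →L[ℝ]
    EuclideanSpace ℝ ι × EuclideanSpace ℝ ι :=
  projLeft.prodMap projLeft

/-- The projection of phase space `ℝ^(ι ⊕ κ) × ℝ^(ι ⊕ κ)` onto `ℝ^κ × ℝ^κ`. -/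
def phaseRight : EuclideanSpace ℝ (ι ⊕ κ) × EuclideanSpace ℝ (ι ⊕ κ) →L[ℝ]
    EuclideanSpace ℝ κ × EuclideanSpace ℝ κ :=
  projRight.prodMap projRight

theorem schwartzShift_schwartzTensor (p : EuclideanSpace ℝ (ι ⊕ κ) × EuclideanSpace ℝ (ι ⊕ κ))
    (φ : 𝓢(EuclideanSpace ℝ ι, ℂ)) (ψ : 𝓢(EuclideanSpace ℝ κ, ℂ)) :
    schwartzShift p (schwartzTensor φ ψ) =
      schwartzTensor (schwartzShift (phaseLeft p) φ) (schwartzShift (phaseRight p) ψ) := by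
  rw [schwartzShift, ContinuousLinearMap.comp_apply, schwartzTranslate_schwartzTensor,
    schwartzModulate_schwartzTensor]
  rfl

/-- Windows on the two factors, and an analysis window that is dual to their tensor product. Their
reproducing formula writes every Schwartz function on `ℝ^(ι ⊕ κ)` as a superposition of tensor
products of Schwartz functions. -/
structure TensorWindow (ι κ : Type*) [Fintype ι] [Fintype κ] where
  /-- The window on the left factor. -/
  left : 𝓢(EuclideanSpace ℝ ι, ℂ)
  /-- The window on the right factor. -/
  right : 𝓢(EuclideanSpace ℝ κ, ℂ)
  /-- The analysis window. -/
  dual : 𝓢(EuclideanSpace ℝ (ι ⊕ κ), ℂ)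
  integral_eq : ∫ t, dual t * schwartzTensor left right t = 1

theorem TensorWindow.nonempty : Nonempty (TensorWindow ι κ) := by
  obtain ⟨φ, hφ⟩ := exists_schwartz_integral_eq_one (V := EuclideanSpace ℝ ι)
  obtain ⟨ψ, hψ⟩ := exists_schwartz_integral_eq_one (V := EuclideanSpace ℝ κ)
  have hne : schwartzTensor φ ψ ≠ 0 := fun hzero => by
    have hone : ∫ z, schwartzTensor φ ψ z = 1 := by rw [integral_schwartzTensor, hφ, hψ, mul_one]
    simp [hzero] at hone
  obtain ⟨G, hG⟩ := exists_integral_mul_eq_one hne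
  exact ⟨⟨φ, ψ, G, hG⟩⟩

end SchwartzTensor

section TensorRealization

variable {ι κ : Type*} [Fintype ι] [Fintype κ] {E F : Type*} [NormedAddCommGroup E]
  [NormedSpace ℂ E] [NormedAddCommGroup F] [NormedSpace ℂ F]
  {J : E →L[ℂ] 𝓢'(EuclideanSpace ℝ ι, ℂ)} {K : F →L[ℂ] 𝓢'(EuclideanSpace ℝ κ, ℂ)}

namespace Realization

variable (R : Realization J) (Q : Realization K) (w : TensorWindow ι κ)

/-- The bounded bilinear form `(e, f) ↦ ⟨e ⊗ f, h⟩` for the time-frequency shift `h` by `p` of the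
tensor product of the windows. -/
def atomForm (p : EuclideanSpace ℝ (ι ⊕ κ) × EuclideanSpace ℝ (ι ⊕ κ)) : E →L[ℂ] F →L[ℂ] ℂ :=
  (R.ev (schwartzShift (phaseLeft p) w.left)).smulRight
    (Q.ev (schwartzShift (phaseRight p) w.right))

theorem atomForm_incl (p : EuclideanSpace ℝ (ι ⊕ κ) × EuclideanSpace ℝ (ι ⊕ κ))
    (φ : 𝓢(EuclideanSpace ℝ ι, ℂ)) (ψ : 𝓢(EuclideanSpace ℝ κ, ℂ)) :
    R.atomForm Q w p (R.incl φ) (Q.incl ψ) =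
      ∫ z, schwartzTensor φ ψ z * schwartzShift p (schwartzTensor w.left w.right) z := by
  rw [schwartzShift_schwartzTensor, integral_schwartzTensor_mul, ← R.apply_incl_apply,
    ← Q.apply_incl_apply]
  rfl

theorem continuous_atomForm : Continuous (R.atomForm Q w) :=
  ((ContinuousLinearMap.smulRightL ℂ E (F →L[ℂ] ℂ)).continuous.comp
    (R.ev.continuous.comp ((continuous_schwartzShift_const w.left).comp
      phaseLeft.continuous))).clm_apply
    (Q.ev.continuous.comp ((continuous_schwartzShift_const w.right).comp phaseRight.continuous))

theorem hasPolynomialGrowth_atomForm : HasPolynomialGrowth (R.atomForm Q w) := by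
  have hR := (R.hasPolynomialGrowth_ev_schwartzShift w.left).comp_linear (phaseLeft (κ := κ))
  have hQ := (Q.hasPolynomialGrowth_ev_schwartzShift w.right).comp_linear (phaseRight (ι := ι))
  exact hR.of_norm_le_mul hQ fun p => (ContinuousLinearMap.norm_smulRight_apply _ _).le

/-- The bounded bilinear form `(e, f) ↦ ⟨e ⊗ f, Θ⟩`, as a function of `Θ`. -/
def tensorForm : 𝓢(EuclideanSpace ℝ (ι ⊕ κ), ℂ) →L[ℂ] E →L[ℂ] F →L[ℂ] ℂ :=
  synthesis w.dual (R.atomForm Q w) (R.continuous_atomForm Q w) (R.hasPolynomialGrowth_atomForm Q w)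

theorem tensorForm_apply (Θ : 𝓢(EuclideanSpace ℝ (ι ⊕ κ), ℂ)) (e : E) (f : F) :
    R.tensorForm Q w Θ e f = ∫ p, stft w.dual Θ p * R.atomForm Q w p e f := by
  let evalAt : (E →L[ℂ] F →L[ℂ] ℂ) →L[ℂ] ℂ :=
    ContinuousLinearMap.apply ℂ ℂ f ∘L ContinuousLinearMap.apply ℂ (F →L[ℂ] ℂ) e
  exact map_synthesis (b := R.atomForm Q w) evalAt w.dual (R.continuous_atomForm Q w)
    (R.hasPolynomialGrowth_atomForm Q w) Θ

theorem tensorForm_incl (Θ : 𝓢(EuclideanSpace ℝ (ι ⊕ κ), ℂ)) (φ : 𝓢(EuclideanSpace ℝ ι, ℂ))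
    (ψ : 𝓢(EuclideanSpace ℝ κ, ℂ)) :
    R.tensorForm Q w Θ (R.incl φ) (Q.incl ψ) = ∫ z, schwartzTensor φ ψ z * Θ z := by
  simp only [tensorForm_apply, atomForm_incl]
  exact integral_stft_mul w.dual _ Θ (schwartzTensor φ ψ) w.integral_eq

theorem tensorForm_schwartzTensor (φ : 𝓢(EuclideanSpace ℝ ι, ℂ)) (ψ : 𝓢(EuclideanSpace ℝ κ, ℂ))
    (e : E) (f : F) : R.tensorForm Q w (schwartzTensor φ ψ) e f = J e φ * K f ψ := by
  change _ = R.ev φ e * Q.ev ψ f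
  refine (R.dense_incl.prodMap Q.dense_incl).induction_on
    (p := fun x : E × F => R.tensorForm Q w (schwartzTensor φ ψ) x.1 x.2 = R.ev φ x.1 * Q.ev ψ x.2)
    (e, f) (isClosed_eq (by fun_prop) (by fun_prop)) fun χ => ?_
  dsimp only [Prod.map]
  rw [tensorForm_incl, ev_apply, ev_apply, apply_incl_apply, apply_incl_apply,
    integral_schwartzTensor_mul]

/-- The map `E ⊗̂_π F → 𝓢'` that sends `e ⊗ f` to the tensor product of distributions. -/
def tensorMap : CompletedProjTensor E F →L[ℂ] 𝓢'(EuclideanSpace ℝ (ι ⊕ κ), ℂ) where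
  toFun u := ContinuousLinearMap.toPointwiseConvergenceCLM ℂ (RingHom.id ℂ) _ ℂ
    (ContinuousLinearMap.apply ℂ ℂ u ∘L projLift ∘L R.tensorForm Q w)
  map_add' u v := DFunLike.ext _ _ fun Θ => map_add (projLift (R.tensorForm Q w Θ)) u v
  map_smul' c u := DFunLike.ext _ _ fun Θ => map_smul (projLift (R.tensorForm Q w Θ)) c u
  cont := PointwiseConvergenceCLM.continuous_of_continuous_eval fun Θ =>
    (projLift (R.tensorForm Q w Θ)).continuous

theorem tensorMap_apply (u : CompletedProjTensor E F) (Θ : 𝓢(EuclideanSpace ℝ (ι ⊕ κ), ℂ)) :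
    R.tensorMap Q w u Θ = projLift (R.tensorForm Q w Θ) u := rfl

theorem isDistributionTensor_tensorMap (e : E) (f : F) :
    IsDistributionTensor (J e) (K f) (R.tensorMap Q w (ctmul e f)) := fun φ ψ => by
  rw [tensorMap_apply, projLift_ctmul, tensorForm_schwartzTensor]

theorem tensorMap_incl (φ : 𝓢(EuclideanSpace ℝ ι, ℂ)) (ψ : 𝓢(EuclideanSpace ℝ κ, ℂ)) :
    R.tensorMap Q w (ctmul (R.incl φ) (Q.incl ψ)) =
      SchwartzMap.toTemperedDistributionCLM (EuclideanSpace ℝ (ι ⊕ κ)) ℂ volume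
        (schwartzTensor φ ψ) := by
  ext Θ
  rw [tensorMap_apply, projLift_ctmul, tensorForm_incl, toTemperedDistributionCLM_apply_eq_integral]

theorem tensorMap_projMap_T (x : EuclideanSpace ℝ (ι ⊕ κ)) (u : CompletedProjTensor E F) :
    R.tensorMap Q w (projMap (R.T (projLeft x)) (Q.T (projRight x)) u) =
      translate x (R.tensorMap Q w u) := by
  refine DFunLike.congr_fun (f := R.tensorMap Q w ∘L projMap _ _)
    (g := translate x ∘L R.tensorMap Q w)
    (eq_of_forall_ctmul_of_denseRange R.dense_incl Q.dense_incl fun φ ψ => ?_) u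
  rw [ContinuousLinearMap.comp_apply, ContinuousLinearMap.comp_apply, projMap_ctmul, R.T_incl,
    Q.T_incl, tensorMap_incl, tensorMap_incl, translate_toTemperedDistributionCLM,
    schwartzTranslate_schwartzTensor]

theorem tensorMap_projMap_M (ξ : EuclideanSpace ℝ (ι ⊕ κ)) (u : CompletedProjTensor E F) :
    R.tensorMap Q w (projMap (R.M (projLeft ξ)) (Q.M (projRight ξ)) u) =
      modulate ξ (R.tensorMap Q w u) := by
  refine DFunLike.congr_fun (f := R.tensorMap Q w ∘L projMap _ _)
    (g := modulate ξ ∘L R.tensorMap Q w)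
    (eq_of_forall_ctmul_of_denseRange R.dense_incl Q.dense_incl fun φ ψ => ?_) u
  rw [ContinuousLinearMap.comp_apply, ContinuousLinearMap.comp_apply, projMap_ctmul, R.M_incl,
    Q.M_incl, tensorMap_incl, tensorMap_incl, modulate_toTemperedDistributionCLM,
    schwartzModulate_schwartzTensor]

variable (F) in
/-- The slice map `E ⊗̂_π F → F` that sends `e ⊗ f` to `⟨e, φ⟩ f`. -/
def slice [CompleteSpace F] (φ : 𝓢(EuclideanSpace ℝ ι, ℂ)) : CompletedProjTensor E F →L[ℂ] F :=
  projLift ((R.ev φ).smulRight (.id ℂ F))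

theorem apply_slice [CompleteSpace F] (φ : 𝓢(EuclideanSpace ℝ ι, ℂ))
    (ψ : 𝓢(EuclideanSpace ℝ κ, ℂ)) (u : CompletedProjTensor E F) :
    K (R.slice F φ u) ψ = R.tensorMap Q w u (schwartzTensor φ ψ) := by
  refine DFunLike.congr_fun (f := Q.ev ψ ∘L R.slice F φ)
    (g := projLift (R.tensorForm Q w (schwartzTensor φ ψ))) (eq_of_forall_ctmul fun e f => ?_) u
  rw [ContinuousLinearMap.comp_apply, slice, projLift_ctmul, projLift_ctmul,
    tensorForm_schwartzTensor]
  simp [ev_apply]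

variable {Q w} in
theorem projMap_eq_zero_of_mem_testOperators {u : CompletedProjTensor E F}
    (hu : R.tensorMap Q w u = 0) {A : E →L[ℂ] E} (hA : A ∈ R.testOperators) :
    projMap A (.id ℂ F) u = 0 := by
  have := Q.complete
  have hslice (φ : 𝓢(EuclideanSpace ℝ ι, ℂ)) : R.slice F φ u = 0 :=
    Q.injective (DFunLike.ext _ _ fun ψ => by rw [R.apply_slice Q w, hu, map_zero]; rfl)
  let P : (E →L[ℂ] E) →L[ℂ] CompletedProjTensor E F :=
    ContinuousLinearMap.apply ℂ _ u ∘L projLift ∘L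
      ContinuousLinearMap.compL ℂ E E (F →L[ℂ] CompletedProjTensor E F) (ctmulCLM E F)
  have hspan : R.testOperators ≤ LinearMap.ker P.toLinearMap := Submodule.span_le.2 <| by
    rintro _ ⟨p, rfl⟩
    refine (projMap_smulRight_id (R.ev p.1) p.2 u).trans ?_
    exact (congrArg (ctmulCLM E F p.2) (hslice p.1)).trans (map_zero _)
  exact hspan hA

theorem tensorMap_injective : Function.Injective (R.tensorMap Q w) := by
  have := R.complete
  refine (injective_iff_map_eq_zero _).2 fun u hu => ?_
  obtain ⟨S, hS, hlim⟩ := R.exists_tendsto_testOperators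
  refine tendsto_nhds_unique (tendsto_projMap_id hlim u) ?_
  simp only [R.projMap_eq_zero_of_mem_testOperators hu (hS _), tendsto_const_nhds]

theorem continuous_ctmul_incl_schwartzShift : Continuous fun p =>
    ctmulCLM E F (R.incl (schwartzShift (phaseLeft p) w.left))
      (Q.incl (schwartzShift (phaseRight p) w.right)) :=
  ((ctmulCLM E F).continuous.comp (R.incl.continuous.comp
    ((continuous_schwartzShift_const w.left).comp phaseLeft.continuous))).clm_apply
      (Q.incl.continuous.comp ((continuous_schwartzShift_const w.right).comp phaseRight.continuous))

theorem hasPolynomialGrowth_ctmul_incl_schwartzShift : HasPolynomialGrowth fun p =>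
    ctmulCLM E F (R.incl (schwartzShift (phaseLeft p) w.left))
      (Q.incl (schwartzShift (phaseRight p) w.right)) := by
  have hR := (R.hasPolynomialGrowth_incl_schwartzShift w.left).comp_linear (phaseLeft (κ := κ))
  have hQ := (Q.hasPolynomialGrowth_incl_schwartzShift w.right).comp_linear (phaseRight (ι := ι))
  exact hR.of_norm_le_mul hQ fun p => norm_ctmul_le _ _

/-- The inclusion of the Schwartz space into `E ⊗̂_π F`. -/
def tensorIncl : 𝓢(EuclideanSpace ℝ (ι ⊕ κ), ℂ) →L[ℂ] CompletedProjTensor E F :=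
  synthesis w.dual _ (R.continuous_ctmul_incl_schwartzShift Q w)
    (R.hasPolynomialGrowth_ctmul_incl_schwartzShift Q w)

theorem tensorMap_tensorIncl (Φ : 𝓢(EuclideanSpace ℝ (ι ⊕ κ), ℂ)) :
    R.tensorMap Q w (R.tensorIncl Q w Φ) =
      SchwartzMap.toTemperedDistributionCLM (EuclideanSpace ℝ (ι ⊕ κ)) ℂ volume Φ := by
  ext Θ
  rw [tensorMap_apply, toTemperedDistributionCLM_apply_eq_integral, tensorIncl, map_synthesis]
  simp only [ctmulCLM_apply, projLift_ctmul, tensorForm_incl, ← schwartzShift_schwartzTensor,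
    smul_eq_mul, mul_comm _ (Θ _)]
  exact integral_stft_mul w.dual _ Φ Θ w.integral_eq

theorem tensorIncl_schwartzTensor (φ : 𝓢(EuclideanSpace ℝ ι, ℂ))
    (ψ : 𝓢(EuclideanSpace ℝ κ, ℂ)) :
    R.tensorIncl Q w (schwartzTensor φ ψ) = ctmul (R.incl φ) (Q.incl ψ) :=
  R.tensorMap_injective Q w (by rw [tensorMap_tensorIncl, tensorMap_incl])

theorem denseRange_tensorIncl : DenseRange (R.tensorIncl Q w) := by
  refine (dense_span_ctmul_of_denseRange R.dense_incl Q.dense_incl).mono ?_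
  refine Submodule.span_le (p := LinearMap.range (R.tensorIncl Q w).toLinearMap).2 ?_
  rintro _ ⟨p, rfl⟩
  exact ⟨_, R.tensorIncl_schwartzTensor Q w p.1 p.2⟩

theorem hasPolynomialGrowth_projMap
    {A : EuclideanSpace ℝ ι → E →L[ℂ] E} {B : EuclideanSpace ℝ κ → F →L[ℂ] F}
    (hA : HasPolynomialGrowth A) (hB : HasPolynomialGrowth B) :
    HasPolynomialGrowth fun x : EuclideanSpace ℝ (ι ⊕ κ) =>
      projMap (A (projLeft x)) (B (projRight x)) := by
  have hA' := hA.comp_linear (projLeft (κ := κ))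
  have hB' := hB.comp_linear (projRight (ι := ι))
  exact hA'.of_norm_le_mul hB' fun x => norm_projMap_le _ _

theorem isTMIB_tensorMap : IsTMIB (R.tensorMap Q w) where
  complete := inferInstance
  injective := R.tensorMap_injective Q w
  dense := denseRange_toTemperedDistributionCLM.mono <| by
    rintro _ ⟨Φ, rfl⟩
    exact ⟨_, R.tensorMap_tensorIncl Q w Φ⟩
  schwartz := ⟨R.tensorIncl Q w, R.tensorMap_tensorIncl Q w, R.denseRange_tensorIncl Q w⟩
  translate_mem x u := ⟨_, R.tensorMap_projMap_T Q w x u⟩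
  modulate_mem ξ u := ⟨_, R.tensorMap_projMap_M Q w ξ u⟩
  growth := by
    obtain ⟨τ, hτ, C, hC, hTM⟩ := ((hasPolynomialGrowth_projMap R.growth_T Q.growth_T).prodMk
      (hasPolynomialGrowth_projMap R.growth_M Q.growth_M)).exists_rpow
    refine ⟨τ, hτ, C, hC, fun x u u' h => ?_, fun ξ u u' h => ?_⟩
    · rw [← R.tensorMap_projMap_T Q w] at h
      rw [R.tensorMap_injective Q w h]
      exact ContinuousLinearMap.le_of_opNorm_le _ ((norm_fst_le _).trans (hTM x)) u
    · rw [← R.tensorMap_projMap_M Q w] at h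
      rw [R.tensorMap_injective Q w h, ← norm_neg ξ]
      exact ContinuousLinearMap.le_of_opNorm_le _ ((norm_snd_le _).trans (hTM (-ξ))) u

end Realization

end TensorRealization

end TMIB

end

theorem mainTheorem9_general {ι : Type*} [Fintype ι] {E : Type*} [NormedAddCommGroup E]
    [NormedSpace ℂ E] (J : E →L[ℂ] 𝓢'(EuclideanSpace ℝ ι, ℂ)) (hE : TMIB.IsTMIB J) :
    (∃ S : ℕ → ℕ → (E →L[ℂ] ℂ) ⊗[ℂ] E, ∃ G : ℕ → (E →L_c[ℂ] E),
      (∀ m, Tendsto (fun n => TMIB.tensorToOperator E (S n m)) atTop (𝓝 (G m))) ∧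
      Tendsto G atTop (𝓝 (TMIB.idOperator E))) ∧
    TMIB.HasWeakSequentialApproximationProperty E ∧
    ∀ {κ : Type*} [Fintype κ] {F : Type*} [NormedAddCommGroup F] [NormedSpace ℂ F]
      (K : F →L[ℂ] 𝓢'(EuclideanSpace ℝ κ, ℂ)), TMIB.IsTMIB K →
      ∃ L : TMIB.CompletedProjTensor E F →L[ℂ] 𝓢'(EuclideanSpace ℝ (ι ⊕ κ), ℂ),
        (∀ (e : E) (f : F), TMIB.IsDistributionTensor (J e) (K f) (L (TMIB.ctmul e f))) ∧
        TMIB.IsTMIB L := by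
  obtain ⟨R⟩ := hE.nonempty_realization
  obtain ⟨s, hs⟩ := R.exists_tendsto_tensorToOperator
  refine ⟨⟨fun _ m => s m, fun m => TMIB.tensorToOperator E (s m), fun m => tendsto_const_nhds, hs⟩,
    ⟨fun m => TMIB.tensorToOperator E (s m), fun m => ⟨s m, rfl⟩, hs⟩,
    fun {κ} _ {_} _ _ K hF => ?_⟩
  obtain ⟨Q⟩ := hF.nonempty_realization
  obtain ⟨w⟩ := TMIB.TensorWindow.nonempty (ι := ι) (κ := κ)
  exact ⟨R.tensorMap Q w, R.isDistributionTensor_tensorMap Q w, R.isTMIB_tensorMap Q w⟩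

theorem mainTheorem9 (d : ℕ) {E : Type*} [NormedAddCommGroup E] [NormedSpace ℂ E]
    (J : E →L[ℂ] 𝓢'(EuclideanSpace ℝ (Fin d), ℂ)) (hE : TMIB.IsTMIB J) :
    (∃ S : ℕ → ℕ → (E →L[ℂ] ℂ) ⊗[ℂ] E, ∃ G : ℕ → (E →L_c[ℂ] E),
      (∀ m, Tendsto (fun n => TMIB.tensorToOperator E (S n m)) atTop (𝓝 (G m))) ∧
      Tendsto G atTop (𝓝 (TMIB.idOperator E))) ∧
    TMIB.HasWeakSequentialApproximationProperty E ∧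
    ∀ {F : Type*} [NormedAddCommGroup F] [NormedSpace ℂ F]
      (K : F →L[ℂ] 𝓢'(EuclideanSpace ℝ (Fin d), ℂ)), TMIB.IsTMIB K →
      ∃ L : TMIB.CompletedProjTensor E F →L[ℂ] 𝓢'(EuclideanSpace ℝ (Fin d ⊕ Fin d), ℂ),
        (∀ (e : E) (f : F), TMIB.IsDistributionTensor (J e) (K f) (L (TMIB.ctmul e f))) ∧
        TMIB.IsTMIB L := by
  obtain ⟨ha, hb, hc⟩ := mainTheorem9_general J hE
  exact ⟨ha, hb, fun K hF => hc K hF⟩
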